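/- **Setting.** Let $\mathcal A_0(\mathbb R)$ be the set of test functions $\varphi\in\mathcal D(\mathbb R)$ (real- or complex-valued) with $\int\varphi=1$, let $\mathcal A_q(\mathbb R)$ be the set of those $\varphi\in\mathcal A_0(\mathbb R)$ with $\int\varphi(x)x^k\,dx=0$ for $1\le k\le q$, and put $\varphi_\varepsilon(x)=\varepsilon^{-1}\varphi(x/\varepsilon)$. Let $\mathcal G(\mathbb R)=\mathcal E_M(\mathbb R)/\mathcal N(\mathbb R)$ be the Colombeau algebra. Here $\mathcal E_M(\mathbb R)$ consists of the maps $u:\mathcal A_0(\mathbb R)\times\mathbb R\to\mathbb C$, smooth in $x$, such that for all compact $K$ and all $k\in\mathbb N_0$ there is $p\in\mathbb N_0$ such that for all $\varphi\in\mathcal A_p(\mathbb R)$ one has $\sup_{x\in K}|\partial^k u(\varphi_\varepsilon,x)|\le c\,\varepsilon^{-p}$ for some $c,\eta>0$ and all $0<\varepsilon<\eta$. Its ideal $\mathcal N(\mathbb R)$ consists of those $u$ such that for all $K,k$ there are $p$ and a strictly increasing sequence of positive numbers $\gamma(n)\to\infty$ such that for all $q\ge p$ and $\varphi\in\mathcal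 A_q(\mathbb R)$ one has $\sup_{x\in K}|\partial^k u(\varphi_\varepsilon,x)|\le c\,\varepsilon^{\gamma(q)-p}$ for some $c,\eta>0$ and all $0<\varepsilon<\eta$. Point values of generalized functions are taken in the ring of generalized numbers, which is defined by the same order-zero estimates for maps $\mathcal A_0(\mathbb R)\to\mathbb C$. A generalized function is *real* if it has a real-valued representative, and *locally bounded* if it has a representative $u$ such that for every compact $K$ there is $p$ such that for all $\varphi\in\mathcal A_p(\mathbb R)$ the functions $u(\varphi_\varepsilon,\cdot)$ are bounded on $K$ uniformly in small $\varepsilon$; for such $X$ and smooth $g:\mathbb R\to\mathbb R$, $g(X)\in\mathcal G(\mathbb R)$ is defined by composition with real-valued representatives. A *generalized delta function* is a $D\in\mathcal G(\mathbb R)$ with a representative such that for some $p$ and all $\varphi\in\mathcal A_p(\mathbb R)$ there is $\eta>0$ with (i) $\operatorname{supp}D(\varphi_\varepsilon,\cdot)\subseteq[-\varepsilon,\varepsilon]$ for $0<\varepsilon<\eta$, (ii) $\int D(\varphi_\varepsilon,x)\,dx\to1$ as $\varepsilon\to0$, (iii) $\int|D(\varphi_\varepsilon,x)|\,dx\le C$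 for $0<\varepsilon<\eta$ with some $C=C(\varphi)$. For $X\in\mathcal G(\mathbb R)$ and a distribution $T\in\mathcal D'(\mathbb R)$, $X\approx T$ means that for some representative of $X$, some $p$ and all $\varphi\in\mathcal A_p(\mathbb R)$, $X(\varphi_\varepsilon,\cdot)\to T$ in $\mathcal D'(\mathbb R)$ as $\varepsilon\to0$. **Theorem.** Let $f\in C^\infty(\mathbb R)$ be real-valued, let $D\in\mathcal G(\mathbb R)$ be a real generalized delta function, and let $x_0,a,b\in\mathbb R$. The geodesic equation $$\ddot X=\tfrac12 f'(X)D,\qquad X(-1)=x_0,\quad \dot X(-1)=0$$ has a unique real, locally bounded solution $X\in\mathcal G(\mathbb R)$. The geodesic deviation equation along $X$, $$\begin{aligned} \ddot N^v&=2[N^xf'(X)D]^{\textstyle\cdot}-N^xf'(X)\dot D+[N^uf(X)D]^{\textstyle\cdot\cdot}-N^uf''(X)\dot X^2D-N^uf'(X)\ddot XD,\\ \ddot N^x&=[\dot N^uf'(X)+\tfrac12N^xf''(X)]D+\tfrac12f'(X)N^u\dot D,\\ \ddot N^y&=\ddot N^u=0, \end{aligned}$$ with initial data $N^a(-1)=(0,0,0,0)$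 and $\dot N^a(-1)=(a,b,0,0)$ (components in the order $u,v,x,y$), has a unique solution $(N^u,N^v,N^x,N^y)\in\mathcal G(\mathbb R)^4$, and it satisfies $$N^x\approx\tfrac12\,a\,f'(x_0)\,(u_++\theta(u)),$$ $$N^v\approx b(1+u)+a\left[f(x_0)\,\delta(u)+\tfrac14f'(x_0)^2\,(\theta(u)+u_+)\right],$$ where $\theta$ is the Heaviside function and $u_+=u\,\theta(u)$. In particular the associated distributions do not depend on the choice of the generalized delta function $D$. -/

import Mathlib

open scoped Distributions ContDiff Topology
open TopologicalSpace MeasureTheory Filter Set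

noncomputable section

namespace Colombeau

/-! ### Mollifiers

`𝕜` is the field (`ℝ` or `ℂ`) in which the mollifiers take their values.  Generalized functions
are complex valued in both cases. -/

/-- The set `𝒜₀(ℝ)` of test functions on `ℝ` with integral one. -/
def A0 (𝕜 : Type*) [RCLike 𝕜] : Type _ :=
  {φ : 𝓓((⊤ : Opens ℝ), 𝕜) // ∫ x, φ x = 1}

section

variable {𝕜 : Type*} [RCLike 𝕜]

/-- The set `𝒜_q(ℝ)` of those `φ ∈ 𝒜₀(ℝ)` whose moments of order `1, …, q` vanish. -/
def A (𝕜 : Type*) [RCLike 𝕜] (q : ℕ) : Set (A0 𝕜) :=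
  {φ | ∀ k : ℕ, 1 ≤ k → k ≤ q → ∫ x : ℝ, (x ^ k) • φ.1 x = 0}

lemma A_anti {p q : ℕ} (h : p ≤ q) : A 𝕜 q ⊆ A 𝕜 p :=
  fun _ hφ k h1 h2 => hφ k h1 (h2.trans h)

/-- The rescaled function `x ↦ ε⁻¹ φ (x / ε)`, for `ε > 0`. -/
def scalePos (φ : A0 𝕜) (ε : ℝ) (hε : 0 < ε) : A0 𝕜 :=
  ⟨{ toFun := fun x => ε⁻¹ • φ.1 (x / ε)
     contDiff' := by
       have h := φ.1.contDiff
       have h2 : ContDiff ℝ _ fun x : ℝ => φ.1 (x / ε) := h.comp (contDiff_id.div_const ε)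
       exact h2.const_smul ε⁻¹
     hasCompactSupport' := by
       have h := φ.1.hasCompactSupport
       have h2 : HasCompactSupport fun x : ℝ => φ.1 (x / ε) := by
         have := h.comp_homeomorph (Homeomorph.mulRight₀ ε⁻¹ (inv_ne_zero hε.ne'))
         simpa [Function.comp_def, div_eq_mul_inv] using this
       exact h2.smul_left (f := fun _ : ℝ => ε⁻¹)
     tsupport_subset' := fun _ _ => trivial }, by
    change ∫ x : ℝ, ε⁻¹ • φ.1 (x / ε) = 1
    rw [integral_smul, Measure.integral_comp_div, φ.2, abs_of_pos hε, smul_smul,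
      inv_mul_cancel₀ hε.ne', one_smul]⟩

/-- `φ_ε(x) = ε⁻¹ φ (x / ε)`.  Only values `ε > 0` are ever used; for the other values of `ε` the
function is left unchanged. -/
def scale (φ : A0 𝕜) (ε : ℝ) : A0 𝕜 :=
  if hε : 0 < ε then scalePos φ ε hε else φ

lemma scale_apply (φ : A0 𝕜) {ε : ℝ} (hε : 0 < ε) (x : ℝ) :
    (scale φ ε).1 x = ε⁻¹ • φ.1 (x / ε) := by
  rw [scale, dif_pos hε]; rfl

/-! ### Growth conditions -/

section growth

variable {ι E : Type*} [NormedField E]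

/-- `‖u(φ_ε, x)‖ ≤ c ε ^ s` for some `c, η > 0`, all `0 < ε < η` and all `x ∈ K`. -/
def DominatedOn (K : Set ι) (u : A0 𝕜 → ι → E) (φ : A0 𝕜) (s : ℝ) : Prop :=
  ∃ c : ℝ, 0 < c ∧ ∃ η : ℝ, 0 < η ∧ ∀ ε : ℝ, 0 < ε → ε < η → ∀ x ∈ K,
    ‖u (scale φ ε) x‖ ≤ c * ε ^ s

/-- Moderate growth on `K`. -/
def ModerateOn (K : Set ι) (u : A0 𝕜 → ι → E) : Prop :=
  ∃ p : ℕ, ∀ φ ∈ A 𝕜 p, DominatedOn K u φ (-(p : ℝ))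

/-- The set `Γ` of strictly increasing sequences of positive numbers that tend to infinity. -/
def Γ : Set (ℕ → ℝ) :=
  {γ | (∀ n, 0 < γ n) ∧ StrictMono γ ∧ Tendsto γ atTop atTop}

/-- Negligibility on `K`. -/
def NegligibleOn (K : Set ι) (u : A0 𝕜 → ι → E) : Prop :=
  ∃ p : ℕ, ∃ γ ∈ Γ, ∀ q : ℕ, p ≤ q → ∀ φ ∈ A 𝕜 q, DominatedOn K u φ (γ q - p)

/-- Boundedness on `K`, uniformly for small `ε`. -/
def BoundedOn (K : Set ι) (u : A0 𝕜 → ι → E) : Prop :=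
  ∃ p : ℕ, ∀ φ ∈ A 𝕜 p, DominatedOn K u φ 0

variable {K : Set ι} {u v : A0 𝕜 → ι → E} {φ : A0 𝕜} {s t : ℝ}

lemma DominatedOn.weaken (h : DominatedOn K u φ s) (hst : t ≤ s) : DominatedOn K u φ t := by
  obtain ⟨c, hc, η, hη, H⟩ := h
  refine ⟨c, hc, min η 1, lt_min hη one_pos, fun ε h0 h1 x hx => ?_⟩
  refine (H ε h0 (h1.trans_le (min_le_left _ _)) x hx).trans ?_
  exact mul_le_mul_of_nonneg_left
    (Real.rpow_le_rpow_of_exponent_ge h0 (h1.le.trans (min_le_right _ _)) hst) hc.le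

lemma DominatedOn.add (h : DominatedOn K u φ s) (h' : DominatedOn K v φ s) :
    DominatedOn K (fun φ x => u φ x + v φ x) φ s := by
  obtain ⟨c, hc, η, hη, H⟩ := h
  obtain ⟨c', hc', η', hη', H'⟩ := h'
  refine ⟨c + c', by positivity, min η η', lt_min hη hη', fun ε h0 h1 x hx => ?_⟩
  rw [add_mul]
  exact (norm_add_le _ _).trans (add_le_add
    (H ε h0 (h1.trans_le (min_le_left _ _)) x hx) (H' ε h0 (h1.trans_le (min_le_right _ _)) x hx))

lemma DominatedOn.mul (h : DominatedOn K u φ s) (h' : DominatedOn K v φ t) :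
    DominatedOn K (fun φ x => u φ x * v φ x) φ (s + t) := by
  obtain ⟨c, hc, η, hη, H⟩ := h
  obtain ⟨c', hc', η', hη', H'⟩ := h'
  refine ⟨c * c', by positivity, min η η', lt_min hη hη', fun ε h0 h1 x hx => ?_⟩
  rw [norm_mul, Real.rpow_add h0, mul_mul_mul_comm]
  exact mul_le_mul (H ε h0 (h1.trans_le (min_le_left _ _)) x hx)
    (H' ε h0 (h1.trans_le (min_le_right _ _)) x hx) (norm_nonneg _) (by positivity)

lemma DominatedOn.mono {F : Type*} [NormedField F] {w : A0 𝕜 → ι → F} (h : DominatedOn K u φ s)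
    (hw : ∀ ψ, ∀ x ∈ K, ‖w ψ x‖ ≤ ‖u ψ x‖) : DominatedOn K w φ s := by
  obtain ⟨c, hc, η, hη, H⟩ := h
  exact ⟨c, hc, η, hη, fun ε h0 h1 x hx => (hw _ x hx).trans (H ε h0 h1 x hx)⟩

lemma dominatedOn_const (c : E) : DominatedOn K (fun _ _ => c) φ 0 :=
  ⟨‖c‖ + 1, by positivity, 1, one_pos, fun ε _ _ x _ => by simp⟩

lemma ModerateOn.add (hu : ModerateOn K u) (hv : ModerateOn K v) :
    ModerateOn K (fun φ x => u φ x + v φ x) := by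
  obtain ⟨p, hp⟩ := hu
  obtain ⟨q, hq⟩ := hv
  refine ⟨max p q, fun φ hφ => ?_⟩
  exact ((hp φ (A_anti (le_max_left _ _) hφ)).weaken (by simp)).add
    ((hq φ (A_anti (le_max_right _ _) hφ)).weaken (by simp))

lemma ModerateOn.mul (hu : ModerateOn K u) (hv : ModerateOn K v) :
    ModerateOn K (fun φ x => u φ x * v φ x) := by
  obtain ⟨p, hp⟩ := hu
  obtain ⟨q, hq⟩ := hv
  refine ⟨p + q, fun φ hφ => ?_⟩
  exact ((hp φ (A_anti (Nat.le_add_right _ _) hφ)).mul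
    (hq φ (A_anti (Nat.le_add_left _ _) hφ))).weaken (by push_cast; linarith)

lemma ModerateOn.mono {F : Type*} [NormedField F] {w : A0 𝕜 → ι → F} (h : ModerateOn K u)
    (hw : ∀ ψ, ∀ x ∈ K, ‖w ψ x‖ ≤ ‖u ψ x‖) : ModerateOn K w := by
  obtain ⟨p, hp⟩ := h
  exact ⟨p, fun φ hφ => (hp φ hφ).mono hw⟩

lemma moderateOn_const (c : E) : ModerateOn (𝕜 := 𝕜) K (fun _ _ => c) :=
  ⟨0, fun φ _ => (dominatedOn_const c).weaken (by simp)⟩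

lemma BoundedOn.moderateOn (h : BoundedOn K u) : ModerateOn K u := by
  obtain ⟨p, hp⟩ := h
  exact ⟨p, fun φ hφ => (hp φ hφ).weaken (by simp)⟩

lemma BoundedOn.add (hu : BoundedOn K u) (hv : BoundedOn K v) :
    BoundedOn K (fun φ x => u φ x + v φ x) := by
  obtain ⟨p, hp⟩ := hu
  obtain ⟨q, hq⟩ := hv
  exact ⟨max p q, fun φ hφ => (hp φ (A_anti (le_max_left _ _) hφ)).add
    (hq φ (A_anti (le_max_right _ _) hφ))⟩

lemma NegligibleOn.add (hu : NegligibleOn K u) (hv : NegligibleOn K v) :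
    NegligibleOn K (fun φ x => u φ x + v φ x) := by
  obtain ⟨p, γ, ⟨hγ0, hγ1, hγ2⟩, hp⟩ := hu
  obtain ⟨p', γ', ⟨hγ0', hγ1', hγ2'⟩, hp'⟩ := hv
  refine ⟨max p p', fun n => min (γ n) (γ' n), ⟨fun n => lt_min (hγ0 n) (hγ0' n), ?_, ?_⟩,
    fun q hq φ hφ => ?_⟩
  · exact fun m n h => min_lt_min (hγ1 h) (hγ1' h)
  · exact tendsto_atTop.2 fun b => by
      filter_upwards [tendsto_atTop.1 hγ2 b, tendsto_atTop.1 hγ2' b] with n h1 h2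
      exact le_min h1 h2
  · refine ((hp q ((le_max_left _ _).trans hq) φ hφ).weaken ?_).add
      ((hp' q ((le_max_right _ _).trans hq) φ hφ).weaken ?_)
    · exact sub_le_sub (min_le_left _ _) (by exact_mod_cast le_max_left _ _)
    · exact sub_le_sub (min_le_right _ _) (by exact_mod_cast le_max_right _ _)

lemma NegligibleOn.mul_moderateOn (hu : NegligibleOn K u) (hv : ModerateOn K v) :
    NegligibleOn K (fun φ x => u φ x * v φ x) := by
  obtain ⟨p, γ, hγ, hp⟩ := hu
  obtain ⟨p', hp'⟩ := hv
  refine ⟨p + p', γ, hγ, fun q hq φ hφ => ?_⟩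
  exact ((hp q ((Nat.le_add_right _ _).trans hq) φ hφ).mul
    (hp' φ (A_anti ((Nat.le_add_left _ _).trans hq) hφ))).weaken (by push_cast; linarith)

lemma NegligibleOn.mono {F : Type*} [NormedField F] {w : A0 𝕜 → ι → F} (h : NegligibleOn K u)
    (hw : ∀ ψ, ∀ x ∈ K, ‖w ψ x‖ ≤ ‖u ψ x‖) : NegligibleOn K w := by
  obtain ⟨p, γ, hγ, hp⟩ := h
  exact ⟨p, γ, hγ, fun q hq φ hφ => (hp q hq φ hφ).mono hw⟩

lemma negligibleOn_zero : NegligibleOn (𝕜 := 𝕜) K (fun _ _ => (0 : E)) :=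
  ⟨0, fun n => n + 1, ⟨fun n => by positivity, fun m n h => by simpa using h,
    tendsto_atTop_add_const_right _ _ tendsto_natCast_atTop_atTop⟩,
    fun q _ φ _ => ⟨1, one_pos, 1, one_pos, fun ε h0 _ x _ => by
      rw [norm_zero]; positivity⟩⟩

lemma NegligibleOn.boundedOn (h : NegligibleOn K u) : BoundedOn K u := by
  obtain ⟨p, γ, ⟨-, -, hγ⟩, hp⟩ := h
  obtain ⟨q, hq1, hq2⟩ := ((tendsto_atTop.1 hγ (p : ℝ)).and (eventually_ge_atTop p)).exists
  exact ⟨q, fun φ hφ => (hp q hq2 φ hφ).weaken (by linarith)⟩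

lemma ModerateOn.sum {α : Type*} (S : Finset α) (w : α → A0 𝕜 → ι → E)
    (h : ∀ i ∈ S, ModerateOn K (w i)) : ModerateOn K (fun φ x => ∑ i ∈ S, w i φ x) := by
  classical
  induction S using Finset.induction_on with
  | empty => simpa using moderateOn_const (0 : E)
  | insert i S hi ih =>
    simp only [Finset.sum_insert hi]
    exact (h i (by simp)).add (ih fun j hj => h j (by simp [hj]))

lemma NegligibleOn.sum {α : Type*} (S : Finset α) (w : α → A0 𝕜 → ι → E)
    (h : ∀ i ∈ S, NegligibleOn K (w i)) : NegligibleOn K (fun φ x => ∑ i ∈ S, w i φ x) := by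
  classical
  induction S using Finset.induction_on with
  | empty => simpa using negligibleOn_zero
  | insert i S hi ih =>
    simp only [Finset.sum_insert hi]
    exact (h i (by simp)).add (ih fun j hj => h j (by simp [hj]))

end growth

/-! ### Growth of all derivatives -/

section derivatives

variable {E : Type*} [NormedField E] [NormedAlgebra ℝ E] {K : Set ℝ} {u v : A0 𝕜 → ℝ → E} {n : ℕ}

lemma moderateOn_iteratedDeriv_add (hu : ∀ φ, ContDiff ℝ ∞ (u φ)) (hv : ∀ φ, ContDiff ℝ ∞ (v φ))
    (h : ModerateOn K fun φ => iteratedDeriv n (u φ))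
    (h' : ModerateOn K fun φ => iteratedDeriv n (v φ)) :
    ModerateOn K fun φ => iteratedDeriv n (fun x => u φ x + v φ x) := by
  refine (h.add h').mono fun ψ x _ => le_of_eq ?_
  rw [iteratedDeriv_fun_add (((hu ψ).of_le (mod_cast le_top)).contDiffAt)
    (((hv ψ).of_le (mod_cast le_top)).contDiffAt)]

lemma negligibleOn_iteratedDeriv_add (hu : ∀ φ, ContDiff ℝ ∞ (u φ))
    (hv : ∀ φ, ContDiff ℝ ∞ (v φ))
    (h : NegligibleOn K fun φ => iteratedDeriv n (u φ))
    (h' : NegligibleOn K fun φ => iteratedDeriv n (v φ)) :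
    NegligibleOn K fun φ => iteratedDeriv n (fun x => u φ x + v φ x) := by
  refine (h.add h').mono fun ψ x _ => le_of_eq ?_
  rw [iteratedDeriv_fun_add (((hu ψ).of_le (mod_cast le_top)).contDiffAt)
    (((hv ψ).of_le (mod_cast le_top)).contDiffAt)]

lemma moderateOn_iteratedDeriv_mul (hu : ∀ φ, ContDiff ℝ ∞ (u φ)) (hv : ∀ φ, ContDiff ℝ ∞ (v φ))
    (h : ∀ k ≤ n, ModerateOn K fun φ => iteratedDeriv k (u φ))
    (h' : ∀ k ≤ n, ModerateOn K fun φ => iteratedDeriv k (v φ)) :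
    ModerateOn K fun φ => iteratedDeriv n (fun x => u φ x * v φ x) := by
  have := ModerateOn.sum (K := K) (Finset.range (n + 1))
    (fun i φ x => (n.choose i : E) * iteratedDeriv i (u φ) x * iteratedDeriv (n - i) (v φ) x)
    (fun i hi => ((moderateOn_const (n.choose i : E)).mul
      (h i (by simpa [Nat.lt_succ_iff] using hi))).mul (h' (n - i) (Nat.sub_le _ _)))
  refine this.mono fun ψ x _ => le_of_eq ?_
  rw [iteratedDeriv_fun_mul (((hu ψ).of_le (mod_cast le_top)).contDiffAt)
    (((hv ψ).of_le (mod_cast le_top)).contDiffAt)]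

lemma negligibleOn_iteratedDeriv_mul (hu : ∀ φ, ContDiff ℝ ∞ (u φ))
    (hv : ∀ φ, ContDiff ℝ ∞ (v φ))
    (h : ∀ k ≤ n, NegligibleOn K fun φ => iteratedDeriv k (u φ))
    (h' : ∀ k ≤ n, ModerateOn K fun φ => iteratedDeriv k (v φ)) :
    NegligibleOn K fun φ => iteratedDeriv n (fun x => u φ x * v φ x) := by
  have := NegligibleOn.sum (K := K) (Finset.range (n + 1))
    (fun i φ x => iteratedDeriv i (u φ) x * ((n.choose i : E) * iteratedDeriv (n - i) (v φ) x))
    (fun i hi => (h i (by simpa [Nat.lt_succ_iff] using hi)).mul_moderateOn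
      ((moderateOn_const (n.choose i : E)).mul (h' (n - i) (Nat.sub_le _ _))))
  refine this.mono fun ψ x _ => le_of_eq ?_
  rw [iteratedDeriv_fun_mul (((hu ψ).of_le (mod_cast le_top)).contDiffAt)
    (((hv ψ).of_le (mod_cast le_top)).contDiffAt)]
  congr 1
  exact Finset.sum_congr rfl fun i _ => by ring

end derivatives

/-! ### The algebra of generalized functions on the line -/

/-- The algebra `ℰ_M(ℝ)` of moderate families. -/
def EM (𝕜 : Type*) [RCLike 𝕜] : Subalgebra ℂ (A0 𝕜 → ℝ → ℂ) where
  carrier := {u | (∀ φ, ContDiff ℝ ∞ (u φ)) ∧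
    ∀ K : Set ℝ, IsCompact K → ∀ k : ℕ, ModerateOn K fun φ => iteratedDeriv k (u φ)}
  mul_mem' := fun {u v} hu hv => ⟨fun φ => (hu.1 φ).mul (hv.1 φ), fun K hK n =>
    moderateOn_iteratedDeriv_mul hu.1 hv.1 (fun k _ => hu.2 K hK k) (fun k _ => hv.2 K hK k)⟩
  add_mem' := fun {u v} hu hv => ⟨fun φ => (hu.1 φ).add (hv.1 φ), fun K hK n =>
    moderateOn_iteratedDeriv_add hu.1 hv.1 (hu.2 K hK n) (hv.2 K hK n)⟩
  algebraMap_mem' := fun c => ⟨fun φ => contDiff_const, fun K hK n => by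
    refine (moderateOn_const c).mono fun ψ x _ => ?_
    change ‖iteratedDeriv n (fun _ : ℝ => c) x‖ ≤ ‖c‖
    rw [iteratedDeriv_const]
    split_ifs <;> simp⟩

/-- The ideal `𝒩(ℝ)` of negligible families. -/
def N (𝕜 : Type*) [RCLike 𝕜] : Ideal (EM 𝕜) where
  carrier := {u | ∀ K : Set ℝ, IsCompact K → ∀ k : ℕ,
    NegligibleOn K fun φ => iteratedDeriv k (u.1 φ)}
  add_mem' := fun {u v} hu hv K hK n =>
    negligibleOn_iteratedDeriv_add u.2.1 v.2.1 (hu K hK n) (hv K hK n)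
  zero_mem' := fun K hK n => negligibleOn_zero.mono fun ψ x _ => by
    change ‖iteratedDeriv n (fun _ : ℝ => (0 : ℂ)) x‖ ≤ ‖(0 : ℂ)‖
    rw [iteratedDeriv_const]
    split_ifs <;> simp
  smul_mem' := fun c u hu K hK n => by
    refine (negligibleOn_iteratedDeriv_mul (n := n) u.2.1 c.2.1 (fun k _ => hu K hK k)
      (fun k _ => c.2.2 K hK k)).mono fun ψ x _ => le_of_eq ?_
    change ‖iteratedDeriv n (fun y => c.1 ψ y * u.1 ψ y) x‖ = _
    simp only [mul_comm]

/-- The Colombeau algebra `𝒢(ℝ) = ℰ_M(ℝ) / 𝒩(ℝ)`. -/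
abbrev G (𝕜 : Type*) [RCLike 𝕜] : Type _ := EM 𝕜 ⧸ N 𝕜

/-- The class of a moderate family. -/
def cl (u : EM 𝕜) : G 𝕜 := Ideal.Quotient.mk (N 𝕜) u

lemma cl_eq_cl {u v : EM 𝕜} : cl u = cl v ↔ u - v ∈ N 𝕜 := Ideal.Quotient.eq

lemma cl_surjective : Function.Surjective (cl (𝕜 := 𝕜)) := Ideal.Quotient.mk_surjective

/-- The derivative of a moderate family. -/
def derivEM (u : EM 𝕜) : EM 𝕜 :=
  ⟨fun φ => deriv (u.1 φ),
    fun φ => (contDiff_infty_iff_deriv.1 (u.2.1 φ)).2, fun K hK k => by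
      simpa only [iteratedDeriv_succ'] using u.2.2 K hK (k + 1)⟩

lemma derivEM_sub_mem {u v : EM 𝕜} (h : u - v ∈ N 𝕜) : derivEM u - derivEM v ∈ N 𝕜 := by
  intro K hK k
  refine (h K hK (k + 1)).mono fun ψ x _ => le_of_eq ?_
  rw [iteratedDeriv_succ']
  congr 2
  funext y
  exact (deriv_sub ((u.2.1 ψ).differentiable (by simp) y)
    ((v.2.1 ψ).differentiable (by simp) y)).symm

/-- The derivative `Ẋ` of a generalized function `X`. -/
def der : G 𝕜 → G 𝕜 :=
  Quotient.lift (fun u => cl (derivEM u)) fun _ _ h =>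
    cl_eq_cl.2 (derivEM_sub_mem ((Submodule.quotientRel_def (N 𝕜)).1 h))

lemma der_cl (u : EM 𝕜) : der (cl u) = cl (derivEM u) := rfl

/-! ### Generalized numbers and point values -/

/-- The ring `ℰ(1)` of moderate families of complex numbers. -/
def EMnum (𝕜 : Type*) [RCLike 𝕜] : Subalgebra ℂ (A0 𝕜 → ℂ) where
  carrier := {z | ModerateOn univ fun φ (_ : Unit) => z φ}
  mul_mem' := fun hu hv => ModerateOn.mul hu hv
  add_mem' := fun hu hv => ModerateOn.add hu hv
  algebraMap_mem' := fun c => moderateOn_const c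

/-- The ideal `𝒩(1)` of negligible families of complex numbers. -/
def Nnum (𝕜 : Type*) [RCLike 𝕜] : Ideal (EMnum 𝕜) where
  carrier := {z | NegligibleOn univ fun φ (_ : Unit) => z.1 φ}
  add_mem' := fun hu hv => NegligibleOn.add hu hv
  zero_mem' := negligibleOn_zero
  smul_mem' := fun c u hu => (NegligibleOn.mul_moderateOn hu c.2).mono fun ψ x _ => by
    change ‖c.1 ψ * u.1 ψ‖ ≤ _
    rw [mul_comm]

/-- The ring of generalized numbers, an algebra over `ℂ`. -/
abbrev GNum (𝕜 : Type*) [RCLike 𝕜] : Type _ := EMnum 𝕜 ⧸ Nnum 𝕜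

/-- The value of a moderate family at a point. -/
def evalEM (t : ℝ) (u : EM 𝕜) : EMnum 𝕜 :=
  ⟨fun φ => u.1 φ t, by
    obtain ⟨p, hp⟩ := u.2.2 {t} isCompact_singleton 0
    refine ⟨p, fun φ hφ => ?_⟩
    obtain ⟨c, hc, η, hη, H⟩ := hp φ hφ
    exact ⟨c, hc, η, hη, fun ε h0 h1 _ _ => by simpa using H ε h0 h1 t rfl⟩⟩

lemma evalEM_apply (t : ℝ) (u : EM 𝕜) (φ : A0 𝕜) : (evalEM t u).1 φ = u.1 φ t := rfl

lemma evalEM_sub_mem (t : ℝ) {u v : EM 𝕜} (h : u - v ∈ N 𝕜) :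
    evalEM t u - evalEM t v ∈ Nnum 𝕜 := by
  obtain ⟨p, γ, hγ, hp⟩ := h {t} isCompact_singleton 0
  refine ⟨p, γ, hγ, fun q hq φ hφ => ?_⟩
  obtain ⟨c, hc, η, hη, H⟩ := hp q hq φ hφ
  exact ⟨c, hc, η, hη, fun ε h0 h1 _ _ => by
    simpa [evalEM_apply] using H ε h0 h1 t rfl⟩

/-- The point value `X(t)`, a generalized number, of a generalized function `X`. -/
def pointValue (X : G 𝕜) (t : ℝ) : GNum 𝕜 :=
  Quotient.lift (fun u => Ideal.Quotient.mk (Nnum 𝕜) (evalEM t u)) (fun _ _ h =>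
    Ideal.Quotient.eq.2 (evalEM_sub_mem t ((Submodule.quotientRel_def (N 𝕜)).1 h))) X

lemma pointValue_cl (u : EM 𝕜) (t : ℝ) :
    pointValue (cl u) t = Ideal.Quotient.mk (Nnum 𝕜) (evalEM t u) := rfl

/-- The embedding of the real numbers into the generalized numbers. -/
def realNum (𝕜 : Type*) [RCLike 𝕜] (c : ℝ) : GNum 𝕜 := algebraMap ℂ (GNum 𝕜) (c : ℂ)

/-! ### Reality, local boundedness and composition with smooth functions -/

/-- A family of functions is real valued. -/
def RealValued (u : EM 𝕜) : Prop := ∀ φ x, (u.1 φ x).im = 0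

/-- A generalized function is real if it has a real-valued representative. -/
def IsReal (X : G 𝕜) : Prop := ∃ u : EM 𝕜, cl u = X ∧ RealValued u

/-- A generalized function is locally bounded if it has a representative which is bounded on
compact sets, uniformly in small `ε`. -/
def IsLocallyBounded (X : G 𝕜) : Prop :=
  ∃ u : EM 𝕜, cl u = X ∧ ∀ K : Set ℝ, IsCompact K → BoundedOn K u.1

/-- If one representative is locally bounded, then all are. -/
lemma IsLocallyBounded.boundedOn {u : EM 𝕜} (h : IsLocallyBounded (cl u)) {K : Set ℝ}
    (hK : IsCompact K) : BoundedOn K u.1 := by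
  obtain ⟨v, hv, hb⟩ := h
  have h1 := (cl_eq_cl.1 hv.symm K hK 0).boundedOn
  obtain ⟨p, hp⟩ := h1.add (u := fun φ => iteratedDeriv 0 ((u - v).1 φ)) (hb K hK)
  exact ⟨p, fun φ hφ => (hp φ hφ).mono fun ψ x _ => by simp⟩

section composition

variable {f : ℝ → ℝ} {K : Set ℝ}

lemma moderateOn_comp {r : A0 𝕜 → ℝ → ℝ} (hr : ∀ φ, ContDiff ℝ ∞ (r φ)) (hb : BoundedOn K r)
    (hm : ∀ k, ModerateOn K fun φ => iteratedDeriv k (r φ)) (n : ℕ) :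
    ∀ f : ℝ → ℝ, ContDiff ℝ ∞ f → ∀ k ≤ n,
      ModerateOn K fun φ => iteratedDeriv k (fun x => f (r φ x)) := by
  have h0 : ∀ f : ℝ → ℝ, ContDiff ℝ ∞ f → ModerateOn K fun φ x => f (r φ x) := by
    intro f hf
    refine BoundedOn.moderateOn ?_
    obtain ⟨p, hp⟩ := hb
    refine ⟨p, fun φ hφ => ?_⟩
    obtain ⟨c, hc, η, hη, H⟩ := hp φ hφ
    obtain ⟨M, hM⟩ := (isCompact_Icc (a := -c) (b := c)).exists_bound_of_continuousOn
      hf.continuous.continuousOn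
    refine ⟨|M| + 1, by positivity, η, hη, fun ε e0 e1 x hx => ?_⟩
    have h2 := H ε e0 e1 x hx
    rw [Real.rpow_zero, mul_one] at h2 ⊢
    exact (hM _ (abs_le.1 h2)).trans ((le_abs_self M).trans (by linarith))
  induction n with
  | zero =>
    intro f hf k hk
    obtain rfl : k = 0 := by omega
    simpa using h0 f hf
  | succ n ih =>
    intro f hf k hk
    rcases k with _ | k
    · simpa using h0 f hf
    have hf' : ContDiff ℝ ∞ (deriv f) := (contDiff_infty_iff_deriv.1 hf).2
    have := moderateOn_iteratedDeriv_mul (n := k) (K := K) (u := fun φ x => deriv f (r φ x))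
      (v := fun φ => deriv (r φ)) (fun φ => hf'.comp (hr φ))
      (fun φ => (contDiff_infty_iff_deriv.1 (hr φ)).2)
      (fun j hj => ih _ hf' j (by omega))
      (fun j _ => by simpa only [iteratedDeriv_succ'] using hm (j + 1))
    refine this.mono fun ψ x _ => le_of_eq ?_
    rw [iteratedDeriv_succ']
    congr 2
    funext y
    exact deriv_comp y (hf.differentiable (by simp) _) ((hr ψ).differentiable (by simp) y)

lemma negligibleOn_comp {r s : A0 𝕜 → ℝ → ℝ} (hr : ∀ φ, ContDiff ℝ ∞ (r φ))
    (hs : ∀ φ, ContDiff ℝ ∞ (s φ)) (hbr : BoundedOn K r) (hbs : BoundedOn K s)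
    (hmr : ∀ k, ModerateOn K fun φ => iteratedDeriv k (r φ))
    (hms : ∀ k, ModerateOn K fun φ => iteratedDeriv k (s φ))
    (hn : ∀ k, NegligibleOn K fun φ => iteratedDeriv k (fun x => r φ x - s φ x)) (n : ℕ) :
    ∀ f : ℝ → ℝ, ContDiff ℝ ∞ f → ∀ k ≤ n,
      NegligibleOn K fun φ => iteratedDeriv k (fun x => f (r φ x) - f (s φ x)) := by
  have h0 : ∀ f : ℝ → ℝ, ContDiff ℝ ∞ f → NegligibleOn K fun φ x => f (r φ x) - f (s φ x) := by
    intro f hf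
    obtain ⟨p, hp⟩ := hbr
    obtain ⟨p', hp'⟩ := hbs
    obtain ⟨p'', γ, hγ, hp''⟩ := hn 0
    have hf' : ContDiff ℝ ∞ (deriv f) := (contDiff_infty_iff_deriv.1 hf).2
    refine ⟨max p'' (max p p'), γ, hγ, fun q hq φ hφ => ?_⟩
    obtain ⟨c, hc, η, hη, H⟩ := hp φ (A_anti (by omega) hφ)
    obtain ⟨c', hc', η', hη', H'⟩ := hp' φ (A_anti (by omega) hφ)
    obtain ⟨c'', hc'', η'', hη'', H''⟩ := (hp'' q (by omega) φ hφ).weaken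
      (t := γ q - (max p'' (max p p') : ℕ))
      (sub_le_sub_left (by exact_mod_cast le_max_left _ _) _)
    obtain ⟨M, hM⟩ := (isCompact_Icc (a := -max c c') (b := max c c')).exists_bound_of_continuousOn
      hf'.continuous.continuousOn
    refine ⟨(|M| + 1) * c'', by positivity, min η (min η' η''),
      lt_min hη (lt_min hη' hη''), fun ε e0 e1 x hx => ?_⟩
    obtain ⟨e2, e3⟩ := lt_min_iff.1 e1
    obtain ⟨e3, e4⟩ := lt_min_iff.1 e3
    have h1 := H ε e0 e2 x hx
    have h2 := H' ε e0 e3 x hx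
    have h3 := H'' ε e0 e4 x hx
    rw [Real.rpow_zero, mul_one] at h1 h2
    have m1 : r (scale φ ε) x ∈ Icc (-max c c') (max c c') :=
      abs_le.1 (h1.trans (le_max_left _ _))
    have m2 : s (scale φ ε) x ∈ Icc (-max c c') (max c c') :=
      abs_le.1 (h2.trans (le_max_right _ _))
    have := (convex_Icc (-max c c') (max c c')).norm_image_sub_le_of_norm_deriv_le
      (f := f) (C := |M| + 1) (fun y _ => hf.differentiable (by simp) y)
      (fun y hy => (hM y hy).trans ((le_abs_self M).trans (by linarith))) m2 m1
    refine this.trans ?_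
    rw [mul_assoc]
    refine mul_le_mul_of_nonneg_left ?_ (by positivity)
    simpa using h3
  induction n with
  | zero =>
    intro f hf k hk
    obtain rfl : k = 0 := by omega
    simpa using h0 f hf
  | succ n ih =>
    intro f hf k hk
    rcases k with _ | k
    · simpa using h0 f hf
    have hf' : ContDiff ℝ ∞ (deriv f) := (contDiff_infty_iff_deriv.1 hf).2
    have hr' : ∀ φ, ContDiff ℝ ∞ (deriv (r φ)) := fun φ => (contDiff_infty_iff_deriv.1 (hr φ)).2
    have hs' : ∀ φ, ContDiff ℝ ∞ (deriv (s φ)) := fun φ => (contDiff_infty_iff_deriv.1 (hs φ)).2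
    have c1 : ∀ φ, ContDiff ℝ ∞ fun x => deriv f (r φ x) := fun φ => hf'.comp (hr φ)
    have c2 : ∀ φ, ContDiff ℝ ∞ fun x => deriv f (s φ x) := fun φ => hf'.comp (hs φ)
    have t1 := negligibleOn_iteratedDeriv_mul (n := k) (K := K)
      (u := fun φ x => deriv f (r φ x) - deriv f (s φ x)) (v := fun φ => deriv (r φ))
      (fun φ => (c1 φ).sub (c2 φ)) hr'
      (fun j hj => ih _ hf' j (by omega))
      (fun j _ => by simpa only [iteratedDeriv_succ'] using hmr (j + 1))
    have t2 := negligibleOn_iteratedDeriv_mul (n := k) (K := K)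
      (u := fun φ x => deriv (r φ) x - deriv (s φ) x) (v := fun φ x => deriv f (s φ x))
      (fun φ => (hr' φ).sub (hs' φ)) c2
      (fun j _ => by
        refine (hn (j + 1)).mono fun ψ x _ => le_of_eq ?_
        rw [iteratedDeriv_succ']
        congr 2
        funext y
        exact (deriv_fun_sub ((hr ψ).differentiable (by simp) y)
          ((hs ψ).differentiable (by simp) y)).symm)
      (fun j _ => moderateOn_comp hs hbs hms j _ hf' j le_rfl)
    have := negligibleOn_iteratedDeriv_add (n := k) (K := K)
      (fun φ => ((c1 φ).sub (c2 φ)).mul (hr' φ)) (fun φ => ((hr' φ).sub (hs' φ)).mul (c2 φ)) t1 t2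
    refine this.mono fun ψ x _ => le_of_eq ?_
    rw [iteratedDeriv_succ']
    congr 2
    funext y
    have d1 : HasDerivAt (fun x => f (r ψ x)) (deriv f (r ψ y) * deriv (r ψ) y) y :=
      (hf.differentiable (by simp) _).hasDerivAt.comp y
        ((hr ψ).differentiable (by simp) y).hasDerivAt
    have d2 : HasDerivAt (fun x => f (s ψ x)) (deriv f (s ψ y) * deriv (s ψ) y) y :=
      (hf.differentiable (by simp) _).hasDerivAt.comp y
        ((hs ψ).differentiable (by simp) y).hasDerivAt
    rw [(d1.fun_sub d2).deriv]
    ring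

lemma iteratedDeriv_re {g : ℝ → ℂ} (hg : ContDiff ℝ ∞ g) (k : ℕ) (x : ℝ) :
    iteratedDeriv k (fun y => (g y).re) x = (iteratedDeriv k g x).re := by
  induction k generalizing g with
  | zero => simp
  | succ k ih =>
    rw [iteratedDeriv_succ', iteratedDeriv_succ', ← ih (contDiff_infty_iff_deriv.1 hg).2]
    congr 1
    funext y
    exact (Complex.reCLM.hasFDerivAt.comp_hasDerivAt y
      (hg.differentiable (by simp) y).hasDerivAt).deriv

lemma iteratedDeriv_ofReal {g : ℝ → ℝ} (hg : ContDiff ℝ ∞ g) (k : ℕ) (x : ℝ) :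
    iteratedDeriv k (fun y => (g y : ℂ)) x = ((iteratedDeriv k g x : ℝ) : ℂ) := by
  induction k generalizing g with
  | zero => simp
  | succ k ih =>
    rw [iteratedDeriv_succ', iteratedDeriv_succ', ← ih (contDiff_infty_iff_deriv.1 hg).2]
    congr 1
    funext y
    exact ((hg.differentiable (by simp) y).hasDerivAt.ofReal_comp).deriv

lemma contDiff_re (u : EM 𝕜) (φ : A0 𝕜) : ContDiff ℝ ∞ fun x => (u.1 φ x).re :=
  Complex.reCLM.contDiff.comp (u.2.1 φ)

lemma moderateOn_re (u : EM 𝕜) (hK : IsCompact K) (k : ℕ) :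
    ModerateOn K fun φ => iteratedDeriv k (fun x => (u.1 φ x).re) :=
  (u.2.2 K hK k).mono fun ψ x _ => by
    rw [iteratedDeriv_re (u.2.1 ψ)]
    exact Complex.abs_re_le_norm _

lemma boundedOn_re {u : EM 𝕜} (h : BoundedOn K u.1) : BoundedOn K fun φ x => (u.1 φ x).re := by
  obtain ⟨p, hp⟩ := h
  exact ⟨p, fun φ hφ => (hp φ hφ).mono fun ψ x _ => Complex.abs_re_le_norm _⟩

/-- The family `f (Re u(φ, x))`, for a smooth function `f` and a locally bounded family `u`.  It is
used for real-valued `u` only, where it is `f (u(φ, x))`. -/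
def compEM (f : ℝ → ℝ) (hf : ContDiff ℝ ∞ f) (u : EM 𝕜) (h : IsLocallyBounded (cl u)) : EM 𝕜 :=
  ⟨fun φ x => (f (u.1 φ x).re : ℂ),
    fun φ => Complex.ofRealCLM.contDiff.comp (hf.comp (contDiff_re u φ)),
    fun K hK k => (moderateOn_comp (contDiff_re u) (boundedOn_re (h.boundedOn hK))
      (moderateOn_re u hK) k f hf k le_rfl).mono fun ψ x _ => by
        have := iteratedDeriv_ofReal (hf.comp (contDiff_re u ψ)) k x
        simp only [Function.comp_def] at this
        rw [this, Complex.norm_real]⟩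

open Classical in
/-- The composition `f(X)` of a smooth function `f` with a real, locally bounded generalized
function `X`: the class of `f(u(φ, x))` for a real-valued representative `u` of `X`.  (The value is
`0` if `f` is not smooth, or `X` is not real and locally bounded; this case is never used.) -/
def comp (f : ℝ → ℝ) (X : G 𝕜) : G 𝕜 :=
  if h : ContDiff ℝ ∞ f ∧ IsReal X ∧ IsLocallyBounded X then
    cl (compEM f h.1 h.2.1.choose (by rw [h.2.1.choose_spec.1]; exact h.2.2))
  else 0

/-- The composition does not depend on the representative. -/
theorem comp_cl (hf : ContDiff ℝ ∞ f) (u : EM 𝕜) (hu : RealValued u)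
    (h : IsLocallyBounded (cl u)) : comp f (cl u) = cl (compEM f hf u h) := by
  have hr : IsReal (cl u) := ⟨u, rfl, hu⟩
  rw [comp, dif_pos ⟨hf, hr, h⟩, cl_eq_cl]
  intro K hK k
  have hspec : cl (Exists.choose hr) = cl u := hr.choose_spec.1
  have hv' : IsLocallyBounded (cl (Exists.choose hr)) := by rw [hspec]; exact h
  change NegligibleOn K fun φ => iteratedDeriv k
    ((compEM f hf (Exists.choose hr) hv' - compEM f hf u h).1 φ)
  generalize Exists.choose hr = v at hspec hv'
  have hv := hv'
  have hn := cl_eq_cl.1 hspec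
  refine (negligibleOn_comp (contDiff_re v) (contDiff_re u) (boundedOn_re (hv.boundedOn hK))
    (boundedOn_re (h.boundedOn hK)) (moderateOn_re v hK) (moderateOn_re u hK)
    (fun j => (hn K hK j).mono fun ψ x _ => ?_) k f hf k le_rfl).mono fun ψ x _ => le_of_eq ?_
  · have e : (fun x => (v.1 ψ x).re - (u.1 ψ x).re) = fun x => ((v - u).1 ψ x).re := by
      funext y; simp
    rw [e, iteratedDeriv_re ((v - u).2.1 ψ)]
    exact Complex.abs_re_le_norm _
  · have e := iteratedDeriv_ofReal
      ((hf.comp (contDiff_re v ψ)).sub (hf.comp (contDiff_re u ψ))) k x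
    simp only [Function.comp_def, Complex.ofReal_sub] at e
    rw [← Complex.norm_real, ← e]
    rfl

end composition

/-! ### Generalized delta functions -/

/-- A generalized delta function: an element of `𝒢(ℝ)` with a representative `d` such that, for
some `p` and all `φ ∈ 𝒜_p(ℝ)`, there is `η > 0` for which the support of `d(φ_ε, ·)` lies in
`[-ε, ε]` and its `L¹`-norm is bounded, for `0 < ε < η`, and its integral tends to `1`. -/
def IsGeneralizedDelta (D : G 𝕜) : Prop :=
  ∃ d : EM 𝕜, cl d = D ∧ ∃ p : ℕ, ∀ φ ∈ A 𝕜 p, ∃ η : ℝ, 0 < η ∧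
    (∀ ε : ℝ, 0 < ε → ε < η → tsupport (d.1 (scale φ ε)) ⊆ Icc (-ε) ε) ∧
    Tendsto (fun ε : ℝ => ∫ x, d.1 (scale φ ε) x) (𝓝[>] 0) (𝓝 1) ∧
    ∃ C : ℝ, 0 < C ∧ ∀ ε : ℝ, 0 < ε → ε < η → ∫ x, ‖d.1 (scale φ ε) x‖ ≤ C

/-! ### Association with distributions -/

/-- `X ≈ T`: the distribution `T` is associated to the generalized function `X`, i.e. for some
representative `u` of `X`, some `p` and all `φ ∈ 𝒜_p(ℝ)` one has `u(φ_ε, ·) → T` in `𝒟'(ℝ)` as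
`ε → 0`. -/
def Associated (X : G 𝕜) (T : 𝓓'((⊤ : Opens ℝ), ℂ)) : Prop :=
  ∃ u : EM 𝕜, cl u = X ∧ ∃ p : ℕ, ∀ φ ∈ A 𝕜 p, ∀ ψ : 𝓓((⊤ : Opens ℝ), ℝ),
    Tendsto (fun ε : ℝ => ∫ x, ψ x • u.1 (scale φ ε) x) (𝓝[>] 0) (𝓝 (T ψ))

/-- The regular distribution given by a locally integrable function. -/
def regular (g : ℝ → ℂ) : 𝓓'((⊤ : Opens ℝ), ℂ) :=
  UniformConvergenceCLM.ofFun _ _ _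
    (TestFunction.integralAgainstBilinCLM (ContinuousLinearMap.lsmul ℝ ℝ) volume g)

lemma regular_apply {g : ℝ → ℂ} (hg : LocallyIntegrable g) (ψ : 𝓓((⊤ : Opens ℝ), ℝ)) :
    regular g ψ = ∫ x, ψ x • g x :=
  TestFunction.integralAgainstBilinCLM_eq_integral (hg.locallyIntegrableOn _)

/-- The Dirac distribution `δ(u)`. -/
def diracDelta : 𝓓'((⊤ : Opens ℝ), ℂ) :=
  Distribution.mapCLM Complex.ofRealCLM (Distribution.delta 0)

/-- The Heaviside distribution `θ(u)`. -/
def heaviside : 𝓓'((⊤ : Opens ℝ), ℂ) := regular fun u => if 0 < u then 1 else 0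

/-- The distribution `u₊ = u θ(u)`. -/
def uPlus : 𝓓'((⊤ : Opens ℝ), ℂ) := regular fun u => ((max u 0 : ℝ) : ℂ)

/-- The distribution `1 + u`. -/
def onePlus : 𝓓'((⊤ : Opens ℝ), ℂ) := regular fun u => 1 + (u : ℂ)

lemma heaviside_apply (ψ : 𝓓((⊤ : Opens ℝ), ℝ)) :
    heaviside ψ = ∫ u : ℝ, ψ u • (if 0 < u then 1 else 0 : ℂ) :=
  regular_apply ((locallyIntegrable_const (1 : ℂ)).indicator measurableSet_Ioi) ψ

lemma uPlus_apply (ψ : 𝓓((⊤ : Opens ℝ), ℝ)) :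
    uPlus ψ = ∫ u : ℝ, ψ u • ((max u 0 : ℝ) : ℂ) :=
  regular_apply (by fun_prop : Continuous fun u : ℝ => ((max u 0 : ℝ) : ℂ)).locallyIntegrable ψ

lemma onePlus_apply (ψ : 𝓓((⊤ : Opens ℝ), ℝ)) :
    onePlus ψ = ∫ u : ℝ, ψ u • (1 + (u : ℂ)) :=
  regular_apply (by fun_prop : Continuous fun u : ℝ => (1 + (u : ℂ))).locallyIntegrable ψ

lemma diracDelta_apply (ψ : 𝓓((⊤ : Opens ℝ), ℝ)) : diracDelta ψ = ((ψ 0 : ℝ) : ℂ) := rfl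

end

/-! ### Geodesics and geodesic deviation -/

/-- Quadruples of components `(u, v, x, y)`. -/
@[ext]
structure FourVector (R : Type*) where
  u : R
  v : R
  x : R
  y : R

section

variable {𝕜 : Type*} [RCLike 𝕜]

/-- `X` is a (real, locally bounded) solution in `𝒢(ℝ)` of the geodesic equation
`Ẍ = ½ f'(X) D` with `X(-1) = x₀` and `Ẋ(-1) = 0`. -/
structure IsGeodesic (f : ℝ → ℝ) (D : G 𝕜) (x₀ : ℝ) (X : G 𝕜) : Prop where
  real : IsReal X
  locallyBounded : IsLocallyBounded X
  eqn : der (der X) = (1 / 2 : ℂ) • (comp (deriv f) X * D)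
  init : pointValue X (-1) = realNum 𝕜 x₀
  init' : pointValue (der X) (-1) = realNum 𝕜 0

/-- `Nf = (N^u, N^v, N^x, N^y)` solves the geodesic deviation equation along `X` in `𝒢(ℝ)⁴` with
`Nf(-1) = n` and first derivative `n'` at `-1`. -/
structure IsDeviation (f : ℝ → ℝ) (D X : G 𝕜) (n n' : FourVector ℝ)
    (Nf : FourVector (G 𝕜)) : Prop where
  eqn_v : der (der Nf.v) =
    2 * der (Nf.x * comp (deriv f) X * D) - Nf.x * comp (deriv f) X * der D
      + der (der (Nf.u * comp f X * D))
      - Nf.u * comp (deriv (deriv f)) X * der X ^ 2 * D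
      - Nf.u * comp (deriv f) X * der (der X) * D
  eqn_x : der (der Nf.x) =
    (der Nf.u * comp (deriv f) X + (1 / 2 : ℂ) • (Nf.x * comp (deriv (deriv f)) X)) * D
      + (1 / 2 : ℂ) • (comp (deriv f) X * Nf.u * der D)
  eqn_y : der (der Nf.y) = 0
  eqn_u : der (der Nf.u) = 0
  init_u : pointValue Nf.u (-1) = realNum 𝕜 n.u
  init_v : pointValue Nf.v (-1) = realNum 𝕜 n.v
  init_x : pointValue Nf.x (-1) = realNum 𝕜 n.x
  init_y : pointValue Nf.y (-1) = realNum 𝕜 n.y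
  init_u' : pointValue (der Nf.u) (-1) = realNum 𝕜 n'.u
  init_v' : pointValue (der Nf.v) (-1) = realNum 𝕜 n'.v
  init_x' : pointValue (der Nf.x) (-1) = realNum 𝕜 n'.x
  init_y' : pointValue (der Nf.y) (-1) = realNum 𝕜 n'.y

end

end Colombeau

end

/-! Everything rests on one mechanism: the coefficient `D` blows up pointwise as ε → 0, but its `L¹`
norm stays bounded and its support shrinks to the origin.

Uniqueness. If `z` satisfies `‖z''‖ ≤ κ‖z‖ + ν` with `κ` bounded in `L¹`, Gronwall's inequality for
the energy `‖z‖² + ‖z'‖² + ν²` bounds `z` by `ν` times a constant that depends only on the time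
interval and on `∫ κ`, hence not on ε (`norm_le_of_norm_second_deriv_le`). So negligible data and a
negligible defect make `z` negligible in order zero, and for moderate families a Landau inequality
promotes this to all derivatives (`mem_N_of_order_zero`). For two geodesics the difference of the
nonlinear terms is linearized by the mean value inequality. The deviation system is triangular:
`N^u` and `N^y` are free motions, `N^x` solves a linear equation of the above type once `N^u` is
known, and `N^u`, `N^x` determine the second derivative of `N^v`.

Existence of the geodesic. Replace `½ f'` by a compactly supported function that agrees with it near
`x₀`. The modified equation has global solutions. Their velocities are bounded by the `L¹` norm of
`D`, so while `D` acts the particle moves only by O(ε) from `x₀` and does not leave the region where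
nothing was changed; elsewhere `D` vanishes. For small ε the original equation therefore holds
exactly (`IsDeltaNet.exists_isGeodesicNet`).

Existence of the deviation field. It is explicit. An affine change of the parameter of a geodesic is
a variation through geodesics, so `1 + u` times the tangent `(1, f(X) D + Ẋ², Ẋ, 0)` is a Jacobi
field, and so is `(1 + u) ∂_v`. The combination with coefficients `a` and `b` has the required data
at `-1`, where `D` and `Ẋ` vanish. That it solves the equations is an identity in a differential
ring (`jacobi_x`, `jacobi_v`), valid in the Colombeau algebra itself.

Association. `Ẋ` is bounded and tends pointwise off the origin to `½ f'(x₀) θ`, so by dominated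
convergence `Ẋ` and also `Ẋ²` have the expected limits. Since `X` tends to `x₀` uniformly on the
shrinking supports, `f(X) D` tends to `f(x₀) δ`. Finally `(1 + u) θ = θ + u₊` and `(1 + u) δ = δ`.
-/

namespace Colombeau

/-! ### Ordinary differential equations -/

section ode

/-- A Gronwall inequality in both directions of time. -/
theorem le_mul_exp_of_abs_deriv_le {E E' k P : ℝ → ℝ} {S T t₀ A : ℝ}
    (hE : ∀ t, HasDerivAt E (E' t) t) (hP : ∀ t, HasDerivAt P (k t) t)
    (h : ∀ t ∈ Icc S T, |E' t| ≤ k t * E t) (ht₀ : t₀ ∈ Icc S T) (hE₀ : 0 ≤ E t₀)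
    (hA : ∀ t ∈ Icc S T, ∀ s ∈ Icc S T, P t - P s ≤ A) {t : ℝ} (ht : t ∈ Icc S T) :
    E t ≤ E t₀ * Real.exp A := by
  -- Integrating factors: `E' ≤ k E` makes `E exp(-P)` antitone to the right of `t₀`, and `E' ≥ -k
  -- E` makes `E exp(P)` monotone to its left.
  rcases le_total t₀ t with h0 | h0
  · have hd : ∀ s, HasDerivAt (fun s => E s * Real.exp (-P s))
        (E' s * Real.exp (-P s) + E s * (Real.exp (-P s) * -k s)) s := fun s =>
      (hE s).mul (hP s).neg.exp
    have hm : AntitoneOn (fun s => E s * Real.exp (-P s)) (Icc t₀ t) :=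
      antitoneOn_of_deriv_nonpos (convex_Icc _ _)
        (fun s _ => (hd s).continuousAt.continuousWithinAt)
        (fun s _ => (hd s).differentiableAt.differentiableWithinAt) fun s hs => by
          rw [interior_Icc] at hs
          rw [(hd s).deriv]
          have := (abs_le.1 (h s ⟨ht₀.1.trans hs.1.le, hs.2.le.trans ht.2⟩)).2
          nlinarith [Real.exp_pos (-P s)]
    have h1 := hm (left_mem_Icc.2 h0) (right_mem_Icc.2 h0) h0
    simp only at h1
    have h2 : E t ≤ E t₀ * Real.exp (P t - P t₀) := by
      have := mul_le_mul_of_nonneg_right h1 (Real.exp_pos (P t)).le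
      rw [mul_assoc, mul_assoc, ← Real.exp_add, ← Real.exp_add] at this
      simpa [sub_eq_neg_add] using this
    exact h2.trans (mul_le_mul_of_nonneg_left (Real.exp_le_exp.2 (hA t ht t₀ ht₀)) hE₀)
  · have hd : ∀ s, HasDerivAt (fun s => E s * Real.exp (P s))
        (E' s * Real.exp (P s) + E s * (Real.exp (P s) * k s)) s := fun s =>
      (hE s).mul (hP s).exp
    have hm : MonotoneOn (fun s => E s * Real.exp (P s)) (Icc t t₀) :=
      monotoneOn_of_deriv_nonneg (convex_Icc _ _)
        (fun s _ => (hd s).continuousAt.continuousWithinAt)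
        (fun s _ => (hd s).differentiableAt.differentiableWithinAt) fun s hs => by
          rw [interior_Icc] at hs
          rw [(hd s).deriv]
          have := (abs_le.1 (h s ⟨ht.1.trans hs.1.le, hs.2.le.trans ht₀.2⟩)).1
          nlinarith [Real.exp_pos (P s)]
    have h1 := hm (left_mem_Icc.2 h0) (right_mem_Icc.2 h0) h0
    simp only at h1
    have h2 : E t ≤ E t₀ * Real.exp (P t₀ - P t) := by
      have := mul_le_mul_of_nonneg_right h1 (Real.exp_pos (-P t)).le
      rw [mul_assoc, mul_assoc, ← Real.exp_add, ← Real.exp_add] at this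
      simpa [sub_eq_add_neg] using this
    exact h2.trans (mul_le_mul_of_nonneg_left (Real.exp_le_exp.2 (hA t₀ ht₀ t ht)) hE₀)

/-- An a priori estimate for second order differential inequalities whose coefficient is
controlled in `L¹` only. -/
theorem norm_le_of_norm_second_deriv_le {z z' z'' : ℝ → ℂ} {κ : ℝ → ℝ} {T ν C t₀ : ℝ}
    (hz : ∀ t, HasDerivAt z (z' t) t) (hz' : ∀ t, HasDerivAt z' (z'' t) t)
    (hκ : Continuous κ) (hκ0 : ∀ t, 0 ≤ κ t) (ht₀ : t₀ ∈ Icc (-T) T)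
    (hC : ∫ t in (-T)..T, κ t ≤ C) (hν : 0 ≤ ν)
    (h : ∀ t ∈ Icc (-T) T, ‖z'' t‖ ≤ κ t * ‖z t‖ + ν)
    (h0 : ‖z t₀‖ ≤ ν) (h1 : ‖z' t₀‖ ≤ ν) {t : ℝ} (ht : t ∈ Icc (-T) T) :
    ‖z t‖ ≤ 2 * Real.exp (4 * T + C) * ν := by
  have hT : -T ≤ T := ht.1.trans ht.2
  have hk : Continuous fun t => 2 + κ t := by fun_prop
  have hk0 : ∀ t, 0 ≤ 2 + κ t := fun t => by linarith [hκ0 t]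
  have hii : ∀ a b, IntervalIntegrable (fun t => 2 + κ t) volume a b :=
    fun a b => hk.intervalIntegrable a b
  -- The summand `ν²` absorbs the inhomogeneity: `2‖z'‖ν ≤ ‖z'‖² + ν²`. Hence the energy satisfies a
  -- homogeneous inequality with rate `2 + κ`, whose integral over `[-T, T]` is at most `4T + C`.
  have hE : ∀ t, HasDerivAt (fun t => ‖z t‖ ^ 2 + ‖z' t‖ ^ 2 + ν ^ 2)
      (2 * inner ℝ (z t) (z' t) + 2 * inner ℝ (z' t) (z'' t)) t := fun t =>
    ((hz t).norm_sq.add (hz' t).norm_sq).add_const _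
  have hP : ∀ t, HasDerivAt (fun t => ∫ s in (-T)..t, (2 + κ s)) (2 + κ t) t := fun t =>
    intervalIntegral.integral_hasDerivAt_right (hii _ _)
      (hk.stronglyMeasurableAtFilter _ _) hk.continuousAt
  have hPT : ∫ s in (-T)..T, (2 + κ s) ≤ 4 * T + C := by
    rw [intervalIntegral.integral_add (by simp) (hκ.intervalIntegrable _ _)]
    simp
    linarith
  have hA0 : 0 ≤ 4 * T + C :=
    (intervalIntegral.integral_nonneg hT fun s _ => hk0 s).trans hPT
  have key := le_mul_exp_of_abs_deriv_le (t₀ := t₀) (A := 4 * T + C) hE hP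
    (fun s hs => ?_) ht₀ (by positivity) (fun s hs r hr => ?_) ht
  · have e1 : 1 ≤ Real.exp (4 * T + C) := Real.one_le_exp hA0
    have n0 := norm_nonneg (z t₀)
    have n1 := norm_nonneg (z' t₀)
    -- The initial energy is at most `3ν²`. Rounding 3 up to 4 and the exponential up to its square
    -- makes the bound a perfect square.
    have h3 : ‖z t₀‖ ^ 2 + ‖z' t₀‖ ^ 2 + ν ^ 2 ≤ 4 * ν ^ 2 := by nlinarith
    refine abs_le_of_sq_le_sq' (a := ‖z t‖) ?_ (by positivity) |>.2
    calc ‖z t‖ ^ 2 ≤ ‖z t‖ ^ 2 + ‖z' t‖ ^ 2 + ν ^ 2 := by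
          nlinarith [sq_nonneg ν, sq_nonneg ‖z' t‖]
      _ ≤ _ := key
      _ ≤ 4 * ν ^ 2 * Real.exp (4 * T + C) := by gcongr
      _ ≤ 4 * ν ^ 2 * (Real.exp (4 * T + C) * Real.exp (4 * T + C)) := by
          gcongr; nlinarith
      _ = _ := by ring
  · have a1 := abs_real_inner_le_norm (z s) (z' s)
    have a2 := abs_real_inner_le_norm (z' s) (z'' s)
    have a3 := h s hs
    have a4 := mul_le_mul_of_nonneg_left a3 (norm_nonneg (z' s))
    have a5 := hκ0 s
    have a6 : |2 * inner ℝ (z s) (z' s) + 2 * inner ℝ (z' s) (z'' s)| ≤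
        2 * (‖z s‖ * ‖z' s‖) + 2 * (‖z' s‖ * ‖z'' s‖) := by
      refine (abs_add_le _ _).trans ?_
      rw [abs_mul, abs_mul, abs_two]
      gcongr
    have b1 := two_mul_le_add_sq ‖z s‖ ‖z' s‖
    have b2 := two_mul_le_add_sq ‖z' s‖ ν
    have b3 := mul_le_mul_of_nonneg_left b1 a5
    nlinarith [mul_nonneg a5 (sq_nonneg ν), sq_nonneg ‖z s‖, sq_nonneg ν]
  · have e : (∫ x in (-T)..s, (2 + κ x)) ≤ ∫ x in (-T)..T, (2 + κ x) :=
      intervalIntegral.integral_mono_interval le_rfl hs.1 hs.2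
        (Eventually.of_forall fun x => hk0 x) (hii _ _)
    have e' : 0 ≤ ∫ x in (-T)..r, (2 + κ x) :=
      intervalIntegral.integral_nonneg hr.1 fun x _ => hk0 x
    linarith

/-- Solutions of smooth second order equations are smooth. -/
lemma contDiff_of_second_deriv {x x' : ℝ → ℝ} {F d : ℝ → ℝ} (hF : ContDiff ℝ ∞ F)
    (hd : ContDiff ℝ ∞ d) (hx : ∀ t, HasDerivAt x (x' t) t)
    (hx' : ∀ t, HasDerivAt x' (F (x t) * d t) t) : ContDiff ℝ ∞ x := by
  have e : deriv x = x' := funext fun t => (hx t).deriv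
  have e' : deriv x' = fun t => F (x t) * d t := funext fun t => (hx' t).deriv
  refine contDiff_infty.2 fun n => ?_
  induction n with
  | zero => exact contDiff_zero.2 (continuous_iff_continuousAt.2 fun t => (hx t).continuousAt)
  | succ n ih =>
    have h2 : ContDiff ℝ n (fun t => F (x t) * d t) :=
      ((hF.of_le (mod_cast le_top)).comp ih).mul (hd.of_le (mod_cast le_top))
    have h1 : ContDiff ℝ (n + 1) x' := contDiff_succ_iff_deriv.2
      ⟨fun t => (hx' t).differentiableAt, by simp, e' ▸ h2⟩
    push_cast
    exact contDiff_succ_iff_deriv.2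
      ⟨fun t => (hx t).differentiableAt, by simp, e ▸ h1.of_le (by simp)⟩

/-- Global solvability of `ẍ = F(x) d(t)` for bounded, Lipschitz `F` and compactly supported
`d`. -/
theorem exists_solution {F d : ℝ → ℝ} {M : NNReal} (hF : ContDiff ℝ ∞ F) (hd : ContDiff ℝ ∞ d)
    (hFb : ∀ y, |F y| ≤ M) (hFL : LipschitzWith M F) (hds : ∀ t, t ∉ Icc (-1 : ℝ) 1 → d t = 0)
    (x₀ : ℝ) : ∃ x : ℝ → ℝ, ContDiff ℝ ∞ x ∧ x (-1) = x₀ ∧ deriv x (-1) = 0 ∧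
      ∀ t, deriv (deriv x) t = F (x t) * d t := by
  obtain ⟨B, hB⟩ := (isCompact_Icc (a := (-1 : ℝ)) (b := 1)).exists_bound_of_continuousOn
    hd.continuous.continuousOn
  have hB' : ∀ t ∈ Icc (-1 : ℝ) 1, |d t| ≤ B.toNNReal := fun t ht =>
    (hB t ht).trans (Real.le_coe_toNNReal B)
  set b : NNReal := B.toNNReal
  -- First order system for `(x, 2ẋ)`. With this scaling, on the ball of radius `2L` both components
  -- of the field are bounded by `L`, so Picard–Lindelöf reaches time distance 2 from `-1`, that is,
  -- all of `[-1, 1]` in one step.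
  let v : ℝ → ℝ × ℝ → ℝ × ℝ := fun t y => (2⁻¹ * y.2, 2 * F y.1 * d t)
  let L : NNReal := 2 * M * b
  have hpl : IsPicardLindelof v (tmin := -1) (tmax := 1) ⟨-1, by simp⟩ (x₀, (0 : ℝ)) (2 * L) 0 L
      (max 2⁻¹ L) := by
    refine ⟨fun t ht => ?_, fun y hy => ?_, fun t ht y hy => ?_, ?_⟩
    · refine LipschitzWith.lipschitzOnWith ?_
      refine LipschitzWith.prodMk (LipschitzWith.of_dist_le_mul fun y w => ?_)
        (LipschitzWith.of_dist_le_mul fun y w => ?_)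
      · rw [Real.dist_eq, ← mul_sub, abs_mul]
        simp only [NNReal.coe_inv, NNReal.coe_ofNat]
        rw [abs_of_pos (by norm_num : (0 : ℝ) < 2⁻¹)]
        gcongr
        exact (Real.dist_eq _ _).symm.le.trans (le_max_right _ _)
      · have h1 := hFL.dist_le_mul y.1 w.1
        have h2 : dist y.1 w.1 ≤ dist y w := le_max_left _ _
        have e : 2 * F y.1 * d t - 2 * F w.1 * d t = 2 * (F y.1 - F w.1) * d t := by ring
        rw [Real.dist_eq, e, abs_mul, abs_mul, abs_two]
        rw [Real.dist_eq] at h1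
        calc 2 * |F y.1 - F w.1| * |d t| ≤ 2 * (M * dist y w) * b := by
              gcongr
              · exact h1.trans (by gcongr)
              · exact hB' t ht
          _ = (L : ℝ) * dist y w := by simp only [L]; push_cast; ring
    · exact (by fun_prop : Continuous fun t => v t y).continuousOn
    · rw [Metric.mem_closedBall, dist_eq_norm, Prod.norm_def] at hy
      have hy2 : |y.2| ≤ 2 * L := by
        have := (le_max_right _ _).trans hy
        simpa using this
      rw [Prod.norm_def]
      refine max_le ?_ ?_
      · simp only [v, norm_mul, Real.norm_eq_abs]
        rw [abs_of_pos (by norm_num : (0 : ℝ) < 2⁻¹)]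
        linarith
      · simp only [v, norm_mul, Real.norm_eq_abs, abs_two]
        simp only [L]
        push_cast
        gcongr
        · exact hFb _
        · exact hB' t ht
    · norm_num
      rw [mul_comm]
  obtain ⟨α, hα0, hα⟩ := hpl.exists_eq_forall_mem_Icc_hasDerivWithinAt₀
  simp only at hα0
  have hαc : ContinuousOn α (Icc (-1) 1) := fun t ht => (hα t ht).continuousWithinAt
  have hα' : ∀ t ∈ Ioo (-1 : ℝ) 1, HasDerivAt α (v t (α t)) t := fun t ht =>
    (hα t (Ioo_subset_Icc_self ht)).hasDerivAt (Icc_mem_nhds ht.1 ht.2)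
  -- `α` is only controlled on `[-1, 1]`. Since `d` vanishes elsewhere, integrating `F(p) d` twice
  -- gives a global solution for any continuous extension `p` of the first component.
  let p : ℝ → ℝ := IccExtend (by norm_num : (-1 : ℝ) ≤ 1) (fun t : Icc (-1 : ℝ) 1 => (α t).1)
  have hp : Continuous p :=
    (continuous_fst.comp (continuousOn_iff_continuous_domRestrict.1 hαc)).Icc_extend'
  have hpe : ∀ t ∈ Icc (-1 : ℝ) 1, p t = (α t).1 := fun t ht => IccExtend_of_mem _ _ ht
  have hg : Continuous fun t => F (p t) * d t := by fun_prop
  let q : ℝ → ℝ := fun t => ∫ s in (-1)..t, F (p s) * d s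
  have hq : ∀ t, HasDerivAt q (F (p t) * d t) t := fun t =>
    intervalIntegral.integral_hasDerivAt_right (hg.intervalIntegrable _ _)
      (hg.stronglyMeasurableAtFilter _ _) hg.continuousAt
  have hqc : Continuous q := continuous_iff_continuousAt.2 fun t => (hq t).continuousAt
  let x : ℝ → ℝ := fun t => x₀ + ∫ s in (-1)..t, q s
  have hx : ∀ t, HasDerivAt x (q t) t := fun t =>
    (intervalIntegral.integral_hasDerivAt_right (hqc.intervalIntegrable _ _)
      (hqc.stronglyMeasurableAtFilter _ _) hqc.continuousAt).const_add _
  have hqe : ∀ t ∈ Icc (-1 : ℝ) 1, q t = 2⁻¹ * (α t).2 := fun t ht => by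
    have := intervalIntegral.integral_eq_sub_of_hasDerivAt_of_le (a := -1) (b := t)
      (f := fun s => 2⁻¹ * (α s).2) (f' := fun s => F (p s) * d s) ht.1
      ((continuous_const.mul continuous_snd).comp_continuousOn
        (hαc.mono (Icc_subset_Icc_right ht.2)))
      (fun s hs => by
        have hs' : s ∈ Ioo (-1 : ℝ) 1 := ⟨hs.1, hs.2.trans_le ht.2⟩
        have := (hasFDerivAt_snd.comp_hasDerivAt s (hα' s hs')).const_mul (2⁻¹ : ℝ)
        rw [hpe s (Ioo_subset_Icc_self hs')]
        refine this.congr_deriv ?_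
        change 2⁻¹ * (2 * F (α s).1 * d s) = _
        ring)
      (hg.intervalIntegrable _ _)
    simp only [q]
    rw [this, hα0]
    simp
  have hxe : ∀ t ∈ Icc (-1 : ℝ) 1, x t = p t := fun t ht => by
    have := intervalIntegral.integral_eq_sub_of_hasDerivAt_of_le (a := -1) (b := t)
      (f := fun s => (α s).1) (f' := q) ht.1
      (continuous_fst.comp_continuousOn (hαc.mono (Icc_subset_Icc_right ht.2)))
      (fun s hs => by
        have hs' : s ∈ Ioo (-1 : ℝ) 1 := ⟨hs.1, hs.2.trans_le ht.2⟩
        rw [hqe s (Ioo_subset_Icc_self hs')]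
        exact hasFDerivAt_fst.comp_hasDerivAt s (hα' s hs'))
      (hqc.intervalIntegrable _ _)
    simp only [x]
    rw [this, hα0, hpe t ht]
    simp
  have hq' : ∀ t, HasDerivAt q (F (x t) * d t) t := fun t => by
    by_cases ht : t ∈ Icc (-1 : ℝ) 1
    · rw [hxe t ht]; exact hq t
    · have := hq t
      rw [hds t ht, mul_zero] at this ⊢
      exact this
  have e : deriv x = q := funext fun t => (hx t).deriv
  refine ⟨x, contDiff_of_second_deriv hF hd hx hq', by simp [x], by simp [e, q], fun t => ?_⟩
  rw [e, (hq' t).deriv]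

end ode

end Colombeau

namespace Colombeau

variable {𝕜 : Type*} [RCLike 𝕜]

/-! ### Differential algebra -/

section algebra

lemma hasDerivAt_EM (u : EM 𝕜) (φ : A0 𝕜) (t : ℝ) :
    HasDerivAt (u.1 φ) ((derivEM u).1 φ t) t :=
  ((u.2.1 φ).differentiable (by simp) t).hasDerivAt

lemma derivEM_add (u v : EM 𝕜) : derivEM (u + v) = derivEM u + derivEM v :=
  Subtype.ext <| funext fun φ => funext fun t => ((hasDerivAt_EM u φ t).add (hasDerivAt_EM v φ t)).deriv

lemma derivEM_sub (u v : EM 𝕜) : derivEM (u - v) = derivEM u - derivEM v :=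
  Subtype.ext <| funext fun φ => funext fun t => ((hasDerivAt_EM u φ t).sub (hasDerivAt_EM v φ t)).deriv

lemma derivEM_mul (u v : EM 𝕜) : derivEM (u * v) = derivEM u * v + u * derivEM v :=
  Subtype.ext <| funext fun φ => funext fun t => ((hasDerivAt_EM u φ t).mul (hasDerivAt_EM v φ t)).deriv

lemma derivEM_algebraMap (c : ℂ) : derivEM (algebraMap ℂ (EM 𝕜) c) = 0 :=
  Subtype.ext <| funext fun _ => funext fun t => (hasDerivAt_const t c).deriv

lemma cl_add (u v : EM 𝕜) : cl (u + v) = cl u + cl v := rfl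

lemma cl_sub (u v : EM 𝕜) : cl (u - v) = cl u - cl v := rfl

lemma cl_mul (u v : EM 𝕜) : cl (u * v) = cl u * cl v := rfl

lemma cl_smul (c : ℂ) (u : EM 𝕜) : cl (c • u) = c • cl u := rfl

lemma cl_algebraMap (c : ℂ) : cl (algebraMap ℂ (EM 𝕜) c) = algebraMap ℂ (G 𝕜) c := rfl

lemma cl_eq_zero {u : EM 𝕜} : cl u = 0 ↔ u ∈ N 𝕜 := Ideal.Quotient.eq_zero_iff_mem

lemma der_add (X Y : G 𝕜) : der (X + Y) = der X + der Y := by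
  obtain ⟨u, rfl⟩ := cl_surjective X
  obtain ⟨v, rfl⟩ := cl_surjective Y
  rw [← cl_add, der_cl, derivEM_add]; rfl

lemma der_sub (X Y : G 𝕜) : der (X - Y) = der X - der Y := by
  obtain ⟨u, rfl⟩ := cl_surjective X
  obtain ⟨v, rfl⟩ := cl_surjective Y
  rw [← cl_sub, der_cl, derivEM_sub]; rfl

lemma der_mul (X Y : G 𝕜) : der (X * Y) = der X * Y + X * der Y := by
  obtain ⟨u, rfl⟩ := cl_surjective X
  obtain ⟨v, rfl⟩ := cl_surjective Y
  rw [← cl_mul, der_cl, derivEM_mul]; rfl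

lemma der_algebraMap (c : ℂ) : der (algebraMap ℂ (G 𝕜) c) = 0 := by
  rw [← cl_algebraMap, der_cl, derivEM_algebraMap]; rfl

lemma pointValue_add (X Y : G 𝕜) (t : ℝ) :
    pointValue (X + Y) t = pointValue X t + pointValue Y t := by
  obtain ⟨u, rfl⟩ := cl_surjective X
  obtain ⟨v, rfl⟩ := cl_surjective Y
  rfl

lemma pointValue_sub (X Y : G 𝕜) (t : ℝ) :
    pointValue (X - Y) t = pointValue X t - pointValue Y t := by
  obtain ⟨u, rfl⟩ := cl_surjective X
  obtain ⟨v, rfl⟩ := cl_surjective Y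
  rfl

lemma pointValue_mul (X Y : G 𝕜) (t : ℝ) :
    pointValue (X * Y) t = pointValue X t * pointValue Y t := by
  obtain ⟨u, rfl⟩ := cl_surjective X
  obtain ⟨v, rfl⟩ := cl_surjective Y
  rfl

lemma pointValue_algebraMap (c : ℂ) (t : ℝ) :
    pointValue (algebraMap ℂ (G 𝕜) c) t = algebraMap ℂ (GNum 𝕜) c := rfl

lemma pointValue_eq_zero {u : EM 𝕜} {t : ℝ} : pointValue (cl u) t = 0 ↔ evalEM t u ∈ Nnum 𝕜 :=
  Ideal.Quotient.eq_zero_iff_mem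

end algebra

/-! ### Eventual estimates -/

section eventually

lemma eventually_nhdsGT_zero_iff {P : ℝ → Prop} :
    (∀ᶠ ε in 𝓝[>] (0 : ℝ), P ε) ↔ ∃ η : ℝ, 0 < η ∧ ∀ ε, 0 < ε → ε < η → P ε := by
  rw [Filter.Eventually, mem_nhdsGT_iff_exists_Ioo_subset]
  exact ⟨fun ⟨η, h0, h⟩ => ⟨η, h0, fun ε h1 h2 => h ⟨h1, h2⟩⟩,
    fun ⟨η, h0, h⟩ => ⟨η, h0, fun ε hε => h ε hε.1 hε.2⟩⟩

/-- In filter form, the thresholds of several estimates are intersected by `filter_upwards` instead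
of by explicit minima. -/
lemma dominatedOn_iff {ι E : Type*} [NormedField E] {K : Set ι} {u : A0 𝕜 → ι → E} {φ : A0 𝕜}
    {s : ℝ} : DominatedOn K u φ s ↔
      ∃ c : ℝ, 0 < c ∧ ∀ᶠ ε in 𝓝[>] (0 : ℝ), ∀ x ∈ K, ‖u (scale φ ε) x‖ ≤ c * ε ^ s := by
  simp only [eventually_nhdsGT_zero_iff]; rfl

lemma eventually_lt_nhdsGT_zero {r : ℝ} (hr : 0 < r) : ∀ᶠ ε in 𝓝[>] (0 : ℝ), ε < r :=
  nhdsWithin_le_nhds (Iio_mem_nhds hr)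

lemma eventually_pos_nhdsGT_zero : ∀ᶠ ε in 𝓝[>] (0 : ℝ), 0 < ε := self_mem_nhdsWithin

/-- Families that agree on `φ_ε` for small `ε` define the same generalized function. -/
lemma cl_eq_of_eventually_eq {u v : EM 𝕜} (p : ℕ)
    (h : ∀ φ ∈ A 𝕜 p, ∀ᶠ ε in 𝓝[>] (0 : ℝ), u.1 (scale φ ε) = v.1 (scale φ ε)) :
    cl u = cl v := by
  refine cl_eq_cl.2 fun K hK k => ?_
  -- Any element of `Γ` will do; one is borrowed from the zero family.
  obtain ⟨p', γ, hγ, -⟩ := negligibleOn_zero (𝕜 := 𝕜) (K := K) (E := ℂ)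
  refine ⟨p, γ, hγ, fun q hq φ hφ => dominatedOn_iff.2 ⟨1, one_pos, ?_⟩⟩
  filter_upwards [h φ (A_anti hq hφ), eventually_pos_nhdsGT_zero] with ε h1 h0 x _
  have e : (u - v).1 (scale φ ε) = fun _ => 0 := by
    funext y
    change u.1 _ y - v.1 _ y = 0
    rw [h1, sub_self]
  rw [e]
  simp only [iteratedDeriv_const]
  rw [ite_self, norm_zero]
  positivity

end eventually

/-! ### Real parts -/

/-- The real part of a moderate family. -/
noncomputable def reEM (u : EM 𝕜) : EM 𝕜 :=
  ⟨fun φ x => ((u.1 φ x).re : ℂ), fun φ => Complex.ofRealCLM.contDiff.comp (contDiff_re u φ),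
    fun K hK k => (moderateOn_re u hK k).mono fun ψ x _ => by
      rw [iteratedDeriv_ofReal (contDiff_re u ψ), Complex.norm_real]⟩

lemma reEM_mem_N {u : EM 𝕜} (h : u ∈ N 𝕜) : reEM u ∈ N 𝕜 := fun K hK k =>
  (h K hK k).mono fun ψ x _ => by
    change ‖iteratedDeriv k (fun y => ((u.1 ψ y).re : ℂ)) x‖ ≤ _
    rw [iteratedDeriv_ofReal (contDiff_re u ψ), Complex.norm_real, iteratedDeriv_re (u.2.1 ψ)]
    exact Complex.abs_re_le_norm _

lemma RealValued.ofReal_re {u : EM 𝕜} (h : RealValued u) (φ : A0 𝕜) (x : ℝ) :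
    ((u.1 φ x).re : ℂ) = u.1 φ x :=
  Complex.ext rfl (h φ x).symm

/-- Any representative of a real generalized function can be replaced by its real part. -/
lemma IsReal.cl_reEM {u : EM 𝕜} (h : IsReal (cl u)) : cl (reEM u) = cl u := by
  obtain ⟨v, hv, hr⟩ := h
  have h1 := reEM_mem_N (cl_eq_cl.1 hv.symm)
  have h2 : reEM (u - v) = reEM u - v :=
    Subtype.ext <| funext fun φ => funext fun x => by
      change (((u.1 φ x - v.1 φ x).re : ℝ) : ℂ) = ((u.1 φ x).re : ℂ) - v.1 φ x
      rw [Complex.sub_re, Complex.ofReal_sub, hr.ofReal_re]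
  rw [h2] at h1
  rw [cl_eq_cl.2 h1, hv]

/-! ### Composition -/

section composition

variable {f : ℝ → ℝ}

/-- The chain rule. -/
theorem der_comp (hf : ContDiff ℝ ∞ f) {X : G 𝕜} (hX : IsReal X) (hb : IsLocallyBounded X) :
    der (comp f X) = comp (deriv f) X * der X := by
  obtain ⟨u, rfl, hu⟩ := hX
  have hf' : ContDiff ℝ ∞ (deriv f) := (contDiff_infty_iff_deriv.1 hf).2
  rw [comp_cl hf u hu hb, comp_cl hf' u hu hb, der_cl, der_cl, ← cl_mul]
  congr 1
  refine Subtype.ext <| funext fun φ => funext fun t => ?_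
  change deriv (fun s => ((f (u.1 φ s).re : ℝ) : ℂ)) t =
    ((deriv f (u.1 φ t).re : ℝ) : ℂ) * (derivEM u).1 φ t
  have h1 : HasDerivAt (fun s => (u.1 φ s).re) ((derivEM u).1 φ t).re t :=
    Complex.reCLM.hasFDerivAt.comp_hasDerivAt t (hasDerivAt_EM u φ t)
  have h2 : (((derivEM u).1 φ t).re : ℂ) = (derivEM u).1 φ t := by
    have e := h1.ofReal_comp
    simp only [hu.ofReal_re] at e
    exact e.unique (hasDerivAt_EM u φ t)
  have h3 := ((hf.differentiable (by simp) _).hasDerivAt.comp t h1).ofReal_comp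
  simp only [Function.comp_apply] at h3
  rw [h3.deriv, Complex.ofReal_mul, h2]

/-- A smooth function is bounded on the compact interval that contains the values. This makes
`f''(X)` an admissible coefficient in the uniqueness argument for `N^x`. -/
lemma isLocallyBounded_comp (hf : ContDiff ℝ ∞ f) {X : G 𝕜} (hX : IsReal X)
    (hb : IsLocallyBounded X) : IsLocallyBounded (comp f X) := by
  obtain ⟨u, rfl, hu⟩ := hX
  refine ⟨_, (comp_cl hf u hu hb).symm, fun K hK => ?_⟩
  obtain ⟨p, hp⟩ := boundedOn_re (hb.boundedOn hK)
  refine ⟨p, fun φ hφ => ?_⟩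
  obtain ⟨c, hc, H⟩ := dominatedOn_iff.1 (hp φ hφ)
  obtain ⟨M, hM⟩ := (isCompact_Icc (a := -c) (b := c)).exists_bound_of_continuousOn
    hf.continuous.continuousOn
  refine dominatedOn_iff.2 ⟨|M| + 1, by positivity, ?_⟩
  filter_upwards [H] with ε h x hx
  have h2 := h x hx
  rw [Real.rpow_zero, mul_one] at h2 ⊢
  change ‖((f (u.1 _ x).re : ℝ) : ℂ)‖ ≤ _
  rw [Complex.norm_real]
  exact (hM _ (abs_le.1 h2)).trans ((le_abs_self M).trans (by linarith))

/-- A moderation estimate for compositions that uses finitely many derivatives only. -/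
lemma moderateOn_comp_of_le {K : Set ℝ} {r : A0 𝕜 → ℝ → ℝ} (hr : ∀ φ, ContDiff ℝ ∞ (r φ))
    (hb : BoundedOn K r) (n : ℕ) (hm : ∀ k ≤ n, ModerateOn K fun φ => iteratedDeriv k (r φ)) :
    ∀ f : ℝ → ℝ, ContDiff ℝ ∞ f → ∀ k ≤ n,
      ModerateOn K fun φ => iteratedDeriv k (fun x => f (r φ x)) := by
  induction n with
  | zero =>
    intro f hf k hk
    obtain rfl : k = 0 := by omega
    obtain ⟨p, hp⟩ := hb
    refine BoundedOn.moderateOn ⟨p, fun φ hφ => ?_⟩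
    obtain ⟨c, hc, H⟩ := dominatedOn_iff.1 (hp φ hφ)
    obtain ⟨M, hM⟩ := (isCompact_Icc (a := -c) (b := c)).exists_bound_of_continuousOn
      hf.continuous.continuousOn
    refine dominatedOn_iff.2 ⟨|M| + 1, by positivity, ?_⟩
    filter_upwards [H] with ε h x hx
    have h2 := h x hx
    rw [Real.rpow_zero, mul_one] at h2 ⊢
    rw [iteratedDeriv_zero]
    exact (hM _ (abs_le.1 h2)).trans ((le_abs_self M).trans (by linarith))
  | succ n ih =>
    intro f hf k hk
    have ih := ih fun k hk => hm k (by omega)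
    rcases k with _ | k
    · exact ih f hf 0 (by omega)
    have hf' : ContDiff ℝ ∞ (deriv f) := (contDiff_infty_iff_deriv.1 hf).2
    have := moderateOn_iteratedDeriv_mul (n := k) (K := K) (u := fun φ x => deriv f (r φ x))
      (v := fun φ => deriv (r φ)) (fun φ => hf'.comp (hr φ))
      (fun φ => (contDiff_infty_iff_deriv.1 (hr φ)).2)
      (fun j hj => ih _ hf' j (by omega))
      (fun j hj => by simpa only [iteratedDeriv_succ'] using hm (j + 1) (by omega))
    refine this.mono fun ψ x _ => le_of_eq ?_
    rw [iteratedDeriv_succ']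
    congr 2
    funext y
    exact deriv_comp y (hf.differentiable (by simp) _) ((hr ψ).differentiable (by simp) y)

end composition

/-! ### Negligibility from estimates of order zero -/

section orderZero

/-- A Landau type inequality. -/
lemma norm_deriv_le_of_norm_le {g g' g'' : ℝ → ℂ} (hg : ∀ t, HasDerivAt g (g' t) t)
    (hg' : ∀ t, HasDerivAt g' (g'' t) t) {x h m M : ℝ} (hh : 0 < h)
    (hM : ∀ t ∈ Icc x (x + h), ‖g'' t‖ ≤ M) (h0 : ‖g x‖ ≤ m) (h1 : ‖g (x + h)‖ ≤ m) :
    ‖g' x‖ ≤ 2 * m / h + M * h := by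
  have hxh : x ≤ x + h := by linarith
  have hM0 : 0 ≤ M := (norm_nonneg _).trans (hM x (left_mem_Icc.2 hxh))
  have e1 : ∀ t ∈ Icc x (x + h), ‖g' t - g' x‖ ≤ M * h := fun t ht =>
    (norm_image_sub_le_of_norm_deriv_le_segment' (fun s _ => (hg' s).hasDerivWithinAt)
      (fun s hs => hM s (Ico_subset_Icc_self hs)) t ht).trans
      (mul_le_mul_of_nonneg_left (by linarith [ht.2]) hM0)
  -- Subtracting the linear function of slope `g' x` leaves a function whose derivative is at most
  -- `M h` on the interval.
  have e2 : ∀ t, HasDerivAt (fun t => g t - (t : ℂ) * g' x) (g' t - 1 * g' x) t := fun t =>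
    (hg t).sub ((hasDerivAt_id t).ofReal_comp.mul_const _)
  have e3 := norm_image_sub_le_of_norm_deriv_le_segment' (fun s _ => (e2 s).hasDerivWithinAt)
    (fun s hs => by simpa using e1 s (Ico_subset_Icc_self hs)) (x + h) (right_mem_Icc.2 hxh)
  have e4 : (h : ℂ) * g' x = g (x + h) - g x -
      (g (x + h) - ((x + h : ℝ) : ℂ) * g' x - (g x - (x : ℂ) * g' x)) := by
    push_cast; ring
  have e5 : h * ‖g' x‖ ≤ m + m + M * h * h := by
    calc h * ‖g' x‖ = ‖(h : ℂ) * g' x‖ := by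
          rw [norm_mul, Complex.norm_real, Real.norm_of_nonneg hh.le]
      _ ≤ _ := by
          rw [e4]
          refine (norm_sub_le _ _).trans (add_le_add ((norm_sub_le _ _).trans
            (add_le_add h1 h0)) ?_)
          simpa using e3
  rw [div_add' _ _ _ hh.ne', le_div_iff₀ hh]
  linarith

/-- Landau's inequality with step `h = ε^(γ(q)/2)`: the quotient by `h` costs half of the order
`γ(q)` of the function, and the term with the second derivative, of moderate growth, gains the same
half. The sequence `γ/2` is again in `Γ`. -/
lemma negligibleOn_deriv {u : EM 𝕜} (h : ∀ K : Set ℝ, IsCompact K → NegligibleOn K u.1)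
    (K : Set ℝ) (hK : IsCompact K) : NegligibleOn K (derivEM u).1 := by
  obtain ⟨T, hT⟩ := hK.isBounded.subset_closedBall 0
  rw [Real.closedBall_eq_Icc, zero_sub, zero_add] at hT
  -- The inequality looks to the right by a step of length at most 1, hence the endpoint `T + 1`.
  obtain ⟨p, γ, ⟨hγ0, hγ1, hγ2⟩, hp⟩ := h (Icc (-T) (T + 1)) isCompact_Icc
  obtain ⟨P, hP⟩ := u.2.2 (Icc (-T) (T + 1)) isCompact_Icc 2
  refine ⟨p + P, fun n => γ n / 2, ⟨fun n => half_pos (hγ0 n),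
    fun m n hmn => div_lt_div_of_pos_right (hγ1 hmn) two_pos,
    hγ2.atTop_div_const two_pos⟩, fun q hq φ hφ => ?_⟩
  obtain ⟨c, hc, H⟩ := dominatedOn_iff.1 (hp q (by omega) φ hφ)
  obtain ⟨c', hc', H'⟩ := dominatedOn_iff.1 (hP φ (A_anti (by omega) hφ))
  refine dominatedOn_iff.2 ⟨2 * c + c', by positivity, ?_⟩
  filter_upwards [H, H', eventually_pos_nhdsGT_zero, eventually_lt_nhdsGT_zero one_pos] with
    ε h1 h2 h3 h4 x hx
  have hx' := hT hx
  have hh : 0 < ε ^ (γ q / 2) := Real.rpow_pos_of_pos h3 _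
  have hh1 : ε ^ (γ q / 2) ≤ 1 := Real.rpow_le_one h3.le h4.le (half_pos (hγ0 q)).le
  have key := norm_deriv_le_of_norm_le (x := x) (h := ε ^ (γ q / 2)) (m := c * ε ^ (γ q - p))
    (M := c' * ε ^ (-(P : ℝ))) (fun t => hasDerivAt_EM u (scale φ ε) t)
    (fun t => hasDerivAt_EM (derivEM u) (scale φ ε) t) hh
    (fun t ht => by
      have := h2 t ⟨hx'.1.trans ht.1, by linarith [ht.2, hx'.2]⟩
      rwa [iteratedDeriv_succ, iteratedDeriv_one] at this)
    (h1 x ⟨hx'.1, by linarith [hx'.2]⟩)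
    (h1 _ ⟨by linarith [hx'.1], by linarith [hx'.2]⟩)
  refine key.trans ?_
  rw [← mul_assoc, mul_div_assoc, ← Real.rpow_sub h3, mul_assoc c', ← Real.rpow_add h3, add_mul]
  gcongr ?_ * ?_ + ?_ * ?_
  · exact Real.rpow_le_rpow_of_exponent_ge h3 h4.le (by push_cast; linarith)
  · exact Real.rpow_le_rpow_of_exponent_ge h3 h4.le (by push_cast; linarith)

/-- A moderate family that satisfies the negligibility estimates of order zero is negligible. -/
theorem mem_N_of_order_zero {u : EM 𝕜} (h : ∀ K : Set ℝ, IsCompact K → NegligibleOn K u.1) :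
    u ∈ N 𝕜 := by
  intro K hK k
  induction k generalizing u with
  | zero => simpa only [iteratedDeriv_zero] using h K hK
  | succ k ih =>
    simp only [iteratedDeriv_succ']
    exact ih (u := derivEM u) (negligibleOn_deriv h)

end orderZero

end Colombeau

namespace Colombeau

variable {𝕜 : Type*} [RCLike 𝕜]

/-! ### Real representatives of generalized delta functions -/

/-- A representative of a real generalized delta function by real functions whose supports lie in
`[-1, 1]`. -/
structure IsDeltaNet (d : EM 𝕜) (δ : A0 𝕜 → ℝ → ℝ) : Prop where
  ofReal : ∀ φ t, d.1 φ t = (δ φ t : ℂ)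
  contDiff : ∀ φ, ContDiff ℝ ∞ (δ φ)
  support : ∀ φ, ∀ t ∉ Icc (-1 : ℝ) 1, δ φ t = 0
  eventually : ∃ p : ℕ, ∀ φ ∈ A 𝕜 p,
    (∀ᶠ ε in 𝓝[>] (0 : ℝ), ∀ t ∉ Icc (-ε) ε, δ (scale φ ε) t = 0) ∧
    (∃ C : ℝ, 0 < C ∧ ∀ᶠ ε in 𝓝[>] (0 : ℝ), ∫ t, |δ (scale φ ε) t| ≤ C) ∧
    Tendsto (fun ε : ℝ => ∫ t, δ (scale φ ε) t) (𝓝[>] 0) (𝓝 1)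

-- Take real parts, and replace by zero every member of the family whose support is not in `[-1,
-- 1]`. For small ε nothing is replaced, so the class is unchanged. In return the support condition
-- holds for every `φ`, so the differential equation can be solved globally for every member of the
-- family.
open Classical in
theorem IsGeneralizedDelta.exists_isDeltaNet {D : G 𝕜} (hD : IsGeneralizedDelta D)
    (hr : IsReal D) : ∃ (d : EM 𝕜) (δ : A0 𝕜 → ℝ → ℝ), cl d = D ∧ IsDeltaNet d δ := by
  obtain ⟨u, rfl, p, hp⟩ := hD
  let δ : A0 𝕜 → ℝ → ℝ := fun φ =>
    if tsupport (u.1 φ) ⊆ Icc (-1) 1 then fun t => (u.1 φ t).re else fun _ => 0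
  have hδ : ∀ φ, ContDiff ℝ ∞ (δ φ) := fun φ => by
    by_cases h : tsupport (u.1 φ) ⊆ Icc (-1) 1
    · simp only [δ, if_pos h]
      exact contDiff_re u φ
    · simp only [δ, if_neg h]
      exact contDiff_const
  let d : EM 𝕜 := ⟨fun φ t => (δ φ t : ℂ), fun φ => Complex.ofRealCLM.contDiff.comp (hδ φ),
    fun K hK k => (moderateOn_re u hK k).mono fun ψ x _ => by
      rw [iteratedDeriv_ofReal (hδ ψ), Complex.norm_real]
      by_cases h : tsupport (u.1 ψ) ⊆ Icc (-1) 1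
      · simp only [δ, if_pos h, le_refl]
      · simp only [δ, if_neg h, iteratedDeriv_const, ite_self, norm_zero, norm_nonneg]⟩
  have he : ∀ φ ∈ A 𝕜 p, ∀ᶠ ε in 𝓝[>] (0 : ℝ), tsupport (u.1 (scale φ ε)) ⊆ Icc (-ε) ε ∧
      δ (scale φ ε) = fun t => (u.1 (scale φ ε) t).re := fun φ hφ => by
    obtain ⟨η, hη, hs, -⟩ := hp φ hφ
    filter_upwards [eventually_pos_nhdsGT_zero, eventually_lt_nhdsGT_zero hη,
      eventually_lt_nhdsGT_zero one_pos] with ε h0 h1 h2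
    have h3 := hs ε h0 h1
    refine ⟨h3, if_pos (h3.trans (Icc_subset_Icc (by linarith) h2.le))⟩
  have hz : ∀ {φ : A0 𝕜} {S : Set ℝ}, tsupport (u.1 φ) ⊆ S → ∀ t ∉ S, u.1 φ t = 0 :=
    fun h t ht => image_eq_zero_of_notMem_tsupport fun h' => ht (h h')
  have hi : ∀ {φ : A0 𝕜} {a b : ℝ}, tsupport (u.1 φ) ⊆ Icc a b → Integrable (u.1 φ) := fun h =>
    (u.2.1 _).continuous.integrable_of_hasCompactSupport
      (HasCompactSupport.of_support_subset_isCompact isCompact_Icc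
        ((subset_tsupport _).trans h))
  refine ⟨d, δ, ?_, fun _ _ => rfl, hδ, fun φ t ht => ?_, p, fun φ hφ => ⟨?_, ?_, ?_⟩⟩
  · rw [← hr.cl_reEM]
    refine cl_eq_of_eventually_eq p fun φ hφ => ?_
    filter_upwards [he φ hφ] with ε h
    funext t
    change ((δ (scale φ ε) t : ℝ) : ℂ) = (((u.1 (scale φ ε) t).re : ℝ) : ℂ)
    rw [h.2]
  · by_cases h : tsupport (u.1 φ) ⊆ Icc (-1) 1
    · simp only [δ, if_pos h]
      rw [hz h t ht, Complex.zero_re]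
    · simp only [δ, if_neg h]
  · filter_upwards [he φ hφ] with ε h t ht
    rw [h.2]
    simp only
    rw [hz h.1 t ht, Complex.zero_re]
  · obtain ⟨η, hη, -, -, C, hC, hb⟩ := hp φ hφ
    refine ⟨C, hC, ?_⟩
    filter_upwards [he φ hφ, eventually_pos_nhdsGT_zero, eventually_lt_nhdsGT_zero hη] with
      ε h h0 h1
    rw [h.2]
    exact (integral_mono_of_nonneg (Eventually.of_forall fun t => abs_nonneg _) (hi h.1).norm
      (Eventually.of_forall fun t => Complex.abs_re_le_norm _)).trans (hb ε h0 h1)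
  · obtain ⟨η, hη, -, ht, -⟩ := hp φ hφ
    have h1 := (Complex.continuous_re.tendsto _).comp ht
    rw [Complex.one_re] at h1
    refine h1.congr' ?_
    filter_upwards [he φ hφ] with ε h
    rw [h.2, Function.comp_apply]
    exact (Complex.reCLM.integral_comp_comm (hi h.1)).symm

namespace IsDeltaNet

variable {d : EM 𝕜} {δ : A0 𝕜 → ℝ → ℝ}

lemma integrable (h : IsDeltaNet d δ) (φ : A0 𝕜) : Integrable (δ φ) :=
  (h.contDiff φ).continuous.integrable_of_hasCompactSupport
    (HasCompactSupport.intro isCompact_Icc (h.support φ))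

/-- The value of a generalized delta function at `-1` vanishes. -/
lemma pointValue_eq_zero (h : IsDeltaNet d δ) : pointValue (cl d) (-1) = 0 := by
  refine Colombeau.pointValue_eq_zero.2 ?_
  obtain ⟨p, hp⟩ := h.eventually
  obtain ⟨p', γ, hγ, -⟩ := negligibleOn_zero (𝕜 := 𝕜) (K := (univ : Set ℝ)) (E := ℂ)
  refine ⟨p, γ, hγ, fun q hq φ hφ => dominatedOn_iff.2 ⟨1, one_pos, ?_⟩⟩
  filter_upwards [(hp φ (A_anti hq hφ)).1, eventually_pos_nhdsGT_zero,
    eventually_lt_nhdsGT_zero one_pos] with ε h1 h0 h2 x _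
  rw [evalEM_apply, h.ofReal, h1 (-1) (fun hm => by linarith [hm.1])]
  simp only [Complex.ofReal_zero, norm_zero]
  positivity

/-! ### Uniqueness for second order equations -/

/-- A family with negligible initial data that satisfies a second order differential inequality
with `L¹`-bounded coefficient and negligible inhomogeneity is negligible. -/
theorem mem_N_of_norm_second_deriv_le (hδ : IsDeltaNet d δ) {z e : EM 𝕜} (he : e ∈ N 𝕜)
    (h0 : evalEM (-1) z ∈ Nnum 𝕜) (h1 : evalEM (-1) (derivEM z) ∈ Nnum 𝕜)
    (H : ∀ T : ℝ, ∃ p : ℕ, ∀ φ ∈ A 𝕜 p, ∃ M : ℝ, 0 ≤ M ∧ ∀ᶠ ε in 𝓝[>] (0 : ℝ),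
      ∀ t ∈ Icc (-T) T, ‖(derivEM (derivEM z)).1 (scale φ ε) t‖ ≤
        M * |δ (scale φ ε) t| * ‖z.1 (scale φ ε) t‖ + ‖e.1 (scale φ ε) t‖) : z ∈ N 𝕜 := by
  refine mem_N_of_order_zero fun K hK => ?_
  obtain ⟨T₀, hT₀⟩ := hK.isBounded.subset_closedBall 0
  rw [Real.closedBall_eq_Icc, zero_sub, zero_add] at hT₀
  obtain ⟨T, hT1, hT⟩ : ∃ T : ℝ, 1 ≤ T ∧ K ⊆ Icc (-T) T :=
    ⟨max T₀ 1, le_max_right _ _, hT₀.trans (Icc_subset_Icc (neg_le_neg (le_max_left _ _))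
      (le_max_left _ _))⟩
  obtain ⟨p₁, hp₁⟩ := hδ.eventually
  obtain ⟨p₂, hp₂⟩ := H T
  -- The initial data and the defect are added up, so that one negligible bound serves as `ν` in the
  -- a priori estimate. Since `1 ≤ T`, the initial time lies in the interval.
  have hN : NegligibleOn (Icc (-T) T)
      (fun φ t => (‖z.1 φ (-1)‖ + ‖(derivEM z).1 φ (-1)‖ + ‖e.1 φ t‖ : ℝ)) := by
    have lift : ∀ {w : EM 𝕜}, evalEM (-1) w ∈ Nnum 𝕜 →
        NegligibleOn (Icc (-T) T) fun φ _ => (‖w.1 φ (-1)‖ : ℝ) := by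
      rintro w ⟨p, γ, hγ, h⟩
      refine ⟨p, γ, hγ, fun q hq φ hφ => ?_⟩
      obtain ⟨c, hc, h⟩ := dominatedOn_iff.1 (h q hq φ hφ)
      refine dominatedOn_iff.2 ⟨c, hc, ?_⟩
      filter_upwards [h] with ε h x _
      rw [norm_norm]
      exact h () trivial
    refine ((lift h0).add (lift h1)).add ?_
    refine (he (Icc (-T) T) isCompact_Icc 0).mono fun ψ x _ => ?_
    rw [norm_norm, iteratedDeriv_zero]
  obtain ⟨p₃, γ, hγ, hp₃⟩ := hN
  refine ⟨p₁ + p₂ + p₃, γ, hγ, fun q hq φ hφ => ?_⟩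
  obtain ⟨c, hc, H3⟩ := dominatedOn_iff.1 ((hp₃ q (by omega) φ hφ).weaken
    (t := γ q - (p₁ + p₂ + p₃ : ℕ)) (by push_cast; linarith))
  obtain ⟨-, ⟨C, hC, H1⟩, -⟩ := hp₁ φ (A_anti (by omega) hφ)
  obtain ⟨M, hM, H2⟩ := hp₂ φ (A_anti (by omega) hφ)
  -- The factor from the a priori estimate, with `M * C` bounding the `L¹` norm of the coefficient;
  -- it does not depend on ε.
  refine dominatedOn_iff.2 ⟨2 * Real.exp (4 * T + M * C) * c, by positivity, ?_⟩
  filter_upwards [H1, H2, H3, eventually_pos_nhdsGT_zero] with ε h1 h2 h3 hε x hx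
  have h3' : ∀ t ∈ Icc (-T) T, ‖z.1 (scale φ ε) (-1)‖ + ‖(derivEM z).1 (scale φ ε) (-1)‖
      + ‖e.1 (scale φ ε) t‖ ≤ c * ε ^ (γ q - (p₁ + p₂ + p₃ : ℕ)) := fun t ht => by
    have := h3 t ht
    rwa [Real.norm_of_nonneg (by positivity)] at this
  have hm : (-1 : ℝ) ∈ Icc (-T) T := ⟨by linarith, by linarith⟩
  rw [mul_assoc]
  have hc := (hδ.contDiff (scale φ ε)).continuous
  refine norm_le_of_norm_second_deriv_le (κ := fun t => M * |δ (scale φ ε) t|)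
    (hasDerivAt_EM z (scale φ ε)) (hasDerivAt_EM (derivEM z) (scale φ ε)) (by fun_prop)
    (fun t => by positivity) hm ?_ (by positivity) (fun t ht => (h2 t ht).trans ?_) ?_ ?_ (hT hx)
  · rw [intervalIntegral.integral_const_mul]
    refine mul_le_mul_of_nonneg_left ?_ hM
    rw [intervalIntegral.integral_of_le (by linarith)]
    exact (setIntegral_le_integral (hδ.integrable _).abs
      (Eventually.of_forall fun t => abs_nonneg _)).trans h1
  · gcongr
    exact (le_add_of_nonneg_left (by positivity)).trans (h3' t ht)
  · refine le_trans ?_ (h3' _ hm)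
    rw [add_assoc]
    exact le_add_of_nonneg_right (by positivity)
  · refine le_trans ?_ (h3' _ hm)
    rw [add_assoc]
    exact (le_add_of_nonneg_right (norm_nonneg _)).trans (le_add_of_nonneg_left (norm_nonneg _))

/-- Uniqueness for linear second order equations in `𝒢(ℝ)` whose coefficient is the product of a
locally bounded generalized function and a generalized delta function. -/
theorem eq_zero_of_der_der_eq (hδ : IsDeltaNet d δ) {Z B : G 𝕜} (hB : IsLocallyBounded B)
    (h : der (der Z) = B * Z * cl d) (h0 : pointValue Z (-1) = 0)
    (h1 : pointValue (der Z) (-1) = 0) : Z = 0 := by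
  obtain ⟨z, rfl⟩ := cl_surjective Z
  obtain ⟨b, rfl⟩ := cl_surjective B
  rw [der_cl] at h1
  rw [der_cl, der_cl, ← cl_mul, ← cl_mul] at h
  refine cl_eq_zero.2 (hδ.mem_N_of_norm_second_deriv_le (cl_eq_cl.1 h)
    (Colombeau.pointValue_eq_zero.1 h0) (Colombeau.pointValue_eq_zero.1 h1) fun T => ?_)
  obtain ⟨p, hp⟩ := hB.boundedOn (K := Icc (-T) T) isCompact_Icc
  refine ⟨p, fun φ hφ => ?_⟩
  obtain ⟨c, hc, H⟩ := dominatedOn_iff.1 (hp φ hφ)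
  refine ⟨c, hc.le, ?_⟩
  filter_upwards [H] with ε h t ht
  have h2 := h t ht
  rw [Real.rpow_zero, mul_one] at h2
  -- The equation holds only modulo negligible families; the second summand is its defect.
  have e : (derivEM (derivEM z)).1 (scale φ ε) t = b.1 (scale φ ε) t * z.1 (scale φ ε) t *
      d.1 (scale φ ε) t + (derivEM (derivEM z) - b * z * d).1 (scale φ ε) t := by
    change _ = _ + ((derivEM (derivEM z)).1 (scale φ ε) t - b.1 (scale φ ε) t *
      z.1 (scale φ ε) t * d.1 (scale φ ε) t)
    ring
  rw [e]
  refine (norm_add_le _ _).trans (add_le_add_left ?_ _)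
  rw [norm_mul, norm_mul, hδ.ofReal, Complex.norm_real, Real.norm_eq_abs, mul_right_comm]
  gcongr

/-- Uniqueness of the solution of the geodesic equation. -/
theorem isGeodesic_unique (hδ : IsDeltaNet d δ) {f : ℝ → ℝ} (hf : ContDiff ℝ ∞ f) {x₀ : ℝ}
    {X Y : G 𝕜} (hX : IsGeodesic f (cl d) x₀ X) (hY : IsGeodesic f (cl d) x₀ Y) : X = Y := by
  obtain ⟨x, rfl, hx⟩ := hX.real
  obtain ⟨y, rfl, hy⟩ := hY.real
  have hf' : ContDiff ℝ ∞ (deriv f) := (contDiff_infty_iff_deriv.1 hf).2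
  have hf'' : ContDiff ℝ ∞ (deriv (deriv f)) := (contDiff_infty_iff_deriv.1 hf').2
  have ex := hX.eqn
  have ey := hY.eqn
  rw [comp_cl hf' x hx hX.locallyBounded, der_cl, der_cl, ← cl_mul, ← cl_smul] at ex
  rw [comp_cl hf' y hy hY.locallyBounded, der_cl, der_cl, ← cl_mul, ← cl_smul] at ey
  set cx := compEM (deriv f) hf' x hX.locallyBounded
  set cy := compEM (deriv f) hf' y hY.locallyBounded
  refine sub_eq_zero.1 (cl_eq_zero.2 (hδ.mem_N_of_norm_second_deriv_le
    ((N 𝕜).sub_mem (cl_eq_cl.1 ex) (cl_eq_cl.1 ey)) ?_ ?_ fun T => ?_))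
  · refine Colombeau.pointValue_eq_zero.1 ?_
    rw [cl_sub, pointValue_sub, hX.init, hY.init, sub_self]
  · refine Colombeau.pointValue_eq_zero.1 ?_
    rw [derivEM_sub, cl_sub, pointValue_sub, ← der_cl, ← der_cl, hX.init', hY.init', sub_self]
  · obtain ⟨p, hp⟩ := boundedOn_re (hX.locallyBounded.boundedOn (K := Icc (-T) T) isCompact_Icc)
    obtain ⟨p', hp'⟩ := boundedOn_re (hY.locallyBounded.boundedOn (K := Icc (-T) T) isCompact_Icc)
    refine ⟨p + p', fun φ hφ => ?_⟩
    obtain ⟨c, hc, H⟩ := dominatedOn_iff.1 (hp φ (A_anti (by omega) hφ))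
    obtain ⟨c', hc', H'⟩ := dominatedOn_iff.1 (hp' φ (A_anti (by omega) hφ))
    obtain ⟨M, hM⟩ := (isCompact_Icc (a := -max c c') (b := max c c')).exists_bound_of_continuousOn
      hf''.continuous.continuousOn
    refine ⟨1 / 2 * |M|, by positivity, ?_⟩
    filter_upwards [H, H'] with ε h h' t ht
    have h1 := h t ht
    have h2 := h' t ht
    rw [Real.rpow_zero, mul_one] at h1 h2
    -- Both representatives take values in one compact interval, on which `f'` has the Lipschitz
    -- constant `|M|`. So the nonlinear difference obeys a linear bound.
    have h3 := (convex_Icc (-max c c') (max c c')).norm_image_sub_le_of_norm_deriv_le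
      (f := deriv f) (C := |M|) (fun y _ => hf'.differentiable (by simp) y)
      (fun y hy => (hM y hy).trans (le_abs_self M)) (abs_le.1 (h2.trans (le_max_right _ _)))
      (abs_le.1 (h1.trans (le_max_left _ _)))
    rw [derivEM_sub, derivEM_sub]
    have e : (derivEM (derivEM x) - derivEM (derivEM y)).1 (scale φ ε) t =
        (1 / 2 : ℂ) * (((deriv f (x.1 (scale φ ε) t).re - deriv f (y.1 (scale φ ε) t).re : ℝ) : ℂ)
          * d.1 (scale φ ε) t) + (derivEM (derivEM x) - (1 / 2 : ℂ) • (cx * d) -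
          (derivEM (derivEM y) - (1 / 2 : ℂ) • (cy * d))).1 (scale φ ε) t := by
      change (derivEM (derivEM x)).1 (scale φ ε) t - (derivEM (derivEM y)).1 (scale φ ε) t = _ +
        ((derivEM (derivEM x)).1 (scale φ ε) t - (1 / 2 : ℂ) *
          (((deriv f (x.1 (scale φ ε) t).re : ℝ) : ℂ) * d.1 (scale φ ε) t) -
        ((derivEM (derivEM y)).1 (scale φ ε) t - (1 / 2 : ℂ) *
          (((deriv f (y.1 (scale φ ε) t).re : ℝ) : ℂ) * d.1 (scale φ ε) t)))
      push_cast
      ring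
    rw [e]
    refine (norm_add_le _ _).trans (add_le_add_left ?_ _)
    rw [norm_mul, norm_mul, hδ.ofReal, Complex.norm_real, Complex.norm_real]
    have h4 : ‖(x.1 (scale φ ε) t).re - (y.1 (scale φ ε) t).re‖ ≤ ‖(x - y).1 (scale φ ε) t‖ :=
      Complex.abs_re_le_norm ((x - y).1 (scale φ ε) t)
    have h5 : ‖(1 / 2 : ℂ)‖ = 1 / 2 := by norm_num
    rw [h5, Real.norm_eq_abs (δ _ _)]
    calc 1 / 2 * (‖deriv f (x.1 (scale φ ε) t).re - deriv f (y.1 (scale φ ε) t).re‖ *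
          |δ (scale φ ε) t|)
        ≤ 1 / 2 * (|M| * ‖(x - y).1 (scale φ ε) t‖ * |δ (scale φ ε) t|) := by
          gcongr
          exact h3.trans (by gcongr)
      _ = _ := by ring

end IsDeltaNet

end Colombeau

namespace Colombeau

variable {𝕜 : Type*} [RCLike 𝕜]

/-! ### Existence of geodesics -/

/-- A representative of a solution of the geodesic equation by real functions, together with its
behaviour near the support of the delta function. -/
structure IsGeodesicNet (f : ℝ → ℝ) (δ : A0 𝕜 → ℝ → ℝ) (x₀ : ℝ) (u : EM 𝕜)
    (x : A0 𝕜 → ℝ → ℝ) : Prop where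
  ofReal : ∀ φ t, u.1 φ t = (x φ t : ℂ)
  contDiff : ∀ φ, ContDiff ℝ ∞ (x φ)
  init : ∀ φ, x φ (-1) = x₀
  init' : ∀ φ, deriv (x φ) (-1) = 0
  eventually : ∃ p : ℕ, ∀ φ ∈ A 𝕜 p, ∃ B : ℝ, 0 ≤ B ∧ ∀ᶠ ε in 𝓝[>] (0 : ℝ),
    (∀ t < -ε, deriv (x (scale φ ε)) t = 0) ∧
    (∀ t, |deriv (x (scale φ ε)) t| ≤ B) ∧
    (∀ t ∈ Icc (-ε) ε, |x (scale φ ε) t - x₀| ≤ B * (3 * ε)) ∧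
    ∀ t, deriv (deriv (x (scale φ ε))) t =
      1 / 2 * deriv f (x (scale φ ε) t) * δ (scale φ ε) t

lemma IsGeodesicNet.derivEM_apply {f : ℝ → ℝ} {δ : A0 𝕜 → ℝ → ℝ} {x₀ : ℝ} {u : EM 𝕜}
    {x : A0 𝕜 → ℝ → ℝ} (h : IsGeodesicNet f δ x₀ u x) (φ : A0 𝕜) (t : ℝ) :
    (derivEM u).1 φ t = ((deriv (x φ) t : ℝ) : ℂ) := by
  have e : u.1 φ = fun t => (x φ t : ℂ) := funext fun t => h.ofReal φ t
  change deriv (u.1 φ) t = _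
  rw [e]
  exact (((h.contDiff φ).differentiable (by simp) t).hasDerivAt.ofReal_comp).deriv

lemma IsGeodesicNet.derivEM_derivEM_apply {f : ℝ → ℝ} {δ : A0 𝕜 → ℝ → ℝ} {x₀ : ℝ} {u : EM 𝕜}
    {x : A0 𝕜 → ℝ → ℝ} (h : IsGeodesicNet f δ x₀ u x) (φ : A0 𝕜) (t : ℝ) :
    (derivEM (derivEM u)).1 φ t = ((deriv (deriv (x φ)) t : ℝ) : ℂ) := by
  have e : (derivEM u).1 φ = fun t => ((deriv (x φ) t : ℝ) : ℂ) := funext fun t => h.derivEM_apply φ t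
  change deriv ((derivEM u).1 φ) t = _
  rw [e]
  exact (((contDiff_infty_iff_deriv.1 (h.contDiff φ)).2.differentiable (by simp)
    t).hasDerivAt.ofReal_comp).deriv

/-- A cut-off of a smooth function: smooth, bounded and Lipschitz. -/
lemma exists_cutoff {g : ℝ → ℝ} (hg : ContDiff ℝ ∞ g) (x₀ : ℝ) :
    ∃ (F : ℝ → ℝ) (M : NNReal), ContDiff ℝ ∞ F ∧ (∀ y, |F y| ≤ M) ∧ LipschitzWith M F ∧
      ∀ y, |y - x₀| ≤ 1 → F y = g y := by
  let χ : ContDiffBump x₀ := ⟨1, 2, one_pos, one_lt_two⟩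
  have h1 : ContDiff ℝ ∞ fun y => χ y * g y := χ.contDiff.mul hg
  have h2 : HasCompactSupport fun y => χ y * g y := χ.hasCompactSupport.mul_right
  obtain ⟨L, hL⟩ := (h1.of_le (m := 1) (by simp)).lipschitzWith_of_hasCompactSupport h2 (by simp)
  obtain ⟨C, hC⟩ := h1.continuous.bounded_above_of_compact_support h2
  refine ⟨_, max L C.toNNReal, h1, fun y => (hC y).trans ?_, hL.weaken (le_max_left _ _),
    fun y hy => ?_⟩
  · exact (Real.le_coe_toNNReal C).trans (by exact_mod_cast le_max_right _ _)
  · rw [χ.one_of_mem_closedBall (by rwa [Metric.mem_closedBall, Real.dist_eq]), one_mul]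

/-- A family of real functions that solves `ẍ = F(x) δ` for a bounded smooth function `F`. -/
structure IsSolutionNet (F : ℝ → ℝ) (δ : A0 𝕜 → ℝ → ℝ) (x₀ : ℝ) (x : A0 𝕜 → ℝ → ℝ) : Prop where
  contDiff : ∀ φ, ContDiff ℝ ∞ (x φ)
  init : ∀ φ, x φ (-1) = x₀
  init' : ∀ φ, deriv (x φ) (-1) = 0
  eqn : ∀ φ t, deriv (deriv (x φ)) t = F (x φ t) * δ φ t

/-! ### A priori estimates for the equation with bounded nonlinearity. -/

namespace IsSolutionNet

variable {d : EM 𝕜} {F : ℝ → ℝ} {δ : A0 𝕜 → ℝ → ℝ} {x₀ : ℝ} {x : A0 𝕜 → ℝ → ℝ} {M : ℝ}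

lemma contDiff_deriv (h : IsSolutionNet F δ x₀ x) (φ : A0 𝕜) : ContDiff ℝ ∞ (deriv (x φ)) :=
  (contDiff_infty_iff_deriv.1 (h.contDiff φ)).2

lemma deriv_eq (h : IsSolutionNet F δ x₀ x) (φ : A0 𝕜) (t : ℝ) :
    deriv (x φ) t = ∫ s in (-1)..t, F (x φ s) * δ φ s := by
  have h1 := intervalIntegral.integral_deriv_eq_sub (f := deriv (x φ)) (a := -1) (b := t)
    (fun s _ => (h.contDiff_deriv φ).differentiable (by simp) s)
    ((contDiff_infty_iff_deriv.1 (h.contDiff_deriv φ)).2.continuous.intervalIntegrable _ _)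
  rw [h.init', sub_zero] at h1
  rw [← h1]
  exact intervalIntegral.integral_congr fun s _ => h.eqn φ s

/-- The velocity vanishes at `-1` and is the integral of `F(x) δ`, so the `L¹` norm of `δ` controls
it at all times. This is why the nonlinearity is cut off: `F` is bounded without prior knowledge of
`x`. -/
lemma abs_deriv_le (h : IsSolutionNet F δ x₀ x) (hδ : IsDeltaNet d δ) (hM : 0 ≤ M)
    (hF : ∀ y, |F y| ≤ M) (φ : A0 𝕜) (t : ℝ) : |deriv (x φ) t| ≤ M * ∫ s, |δ φ s| := by
  rw [h.deriv_eq, ← Real.norm_eq_abs]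
  refine intervalIntegral.norm_integral_le_integral_norm_uIoc.trans ?_
  have hi : Integrable fun s => M * |δ φ s| := (hδ.integrable φ).abs.const_mul M
  rw [← integral_const_mul]
  refine (integral_mono_of_nonneg (Eventually.of_forall fun s => norm_nonneg _) hi.integrableOn
    (Eventually.of_forall fun s => ?_)).trans
    (setIntegral_le_integral hi (Eventually.of_forall fun s => ?_))
  · simp only [norm_mul, Real.norm_eq_abs]
    exact mul_le_mul_of_nonneg_right (hF _) (abs_nonneg _)
  · exact mul_nonneg hM (abs_nonneg _)

lemma eventually_abs_deriv_le (h : IsSolutionNet F δ x₀ x) (hδ : IsDeltaNet d δ) (hM : 0 ≤ M)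
    (hF : ∀ y, |F y| ≤ M) : ∃ p : ℕ, ∀ φ ∈ A 𝕜 p, ∃ B : ℝ, 0 ≤ B ∧ ∀ᶠ ε in 𝓝[>] (0 : ℝ),
      ∀ t, |deriv (x (scale φ ε)) t| ≤ B := by
  obtain ⟨p, hp⟩ := hδ.eventually
  refine ⟨p, fun φ hφ => ?_⟩
  obtain ⟨-, ⟨C, hC, h1⟩, -⟩ := hp φ hφ
  refine ⟨M * C, by positivity, ?_⟩
  filter_upwards [h1] with ε h1 t
  exact (h.abs_deriv_le hδ hM hF _ t).trans (mul_le_mul_of_nonneg_left h1 hM)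

lemma abs_sub_le (h : IsSolutionNet F δ x₀ x) {φ : A0 𝕜} {B : ℝ}
    (hB : ∀ t, |deriv (x φ) t| ≤ B) (s t : ℝ) : |x φ t - x φ s| ≤ B * |t - s| :=
  convex_univ.norm_image_sub_le_of_norm_deriv_le
    (fun y _ => (h.contDiff φ).differentiable (by simp) y) (fun y _ => hB y) trivial trivial

lemma boundedOn (h : IsSolutionNet F δ x₀ x) (hδ : IsDeltaNet d δ) (hM : 0 ≤ M)
    (hF : ∀ y, |F y| ≤ M) (T : ℝ) : BoundedOn (Icc (-T) T) x := by
  obtain ⟨p, hp⟩ := h.eventually_abs_deriv_le hδ hM hF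
  refine ⟨p, fun φ hφ => ?_⟩
  obtain ⟨B, hB, H⟩ := hp φ hφ
  refine dominatedOn_iff.2 ⟨B * (|T| + 1) + |x₀| + 1, by positivity, ?_⟩
  filter_upwards [H] with ε h1 t ht
  have h2 := h.abs_sub_le h1 (-1) t
  rw [h.init] at h2
  rw [Real.rpow_zero, mul_one, Real.norm_eq_abs]
  have h3 : |t - -1| ≤ |T| + 1 := by
    have := abs_le.2 ht
    rw [sub_neg_eq_add]
    refine (abs_add_le _ _).trans ?_
    rw [abs_one]
    linarith [le_abs_self T]
  have h4 := abs_sub_abs_le_abs_sub (x (scale φ ε) t) x₀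
  have h5 := mul_le_mul_of_nonneg_left h3 hB
  linarith

/-- Bootstrap: `x` and its first derivative are bounded, and the derivative of order `n + 2` is the
one of order `n` of `F(x) δ`, which involves `x` only up to order `n`. The composition estimate must
therefore use finitely many derivatives, as in `moderateOn_comp_of_le`. -/
lemma moderateOn (h : IsSolutionNet F δ x₀ x) (hδ : IsDeltaNet d δ) (hF' : ContDiff ℝ ∞ F)
    (hM : 0 ≤ M) (hF : ∀ y, |F y| ≤ M) (T : ℝ) (n : ℕ) : ∀ k ≤ n,
    ModerateOn (Icc (-T) T) fun φ => iteratedDeriv k (x φ) := by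
  have h0 := h.boundedOn hδ hM hF T
  have hδm : ∀ k, ModerateOn (Icc (-T) T) fun φ => iteratedDeriv k (δ φ) := fun k =>
    (d.2.2 (Icc (-T) T) isCompact_Icc k).mono fun ψ t _ => by
      have e : d.1 ψ = fun t => (δ ψ t : ℂ) := funext fun t => hδ.ofReal ψ t
      rw [e, iteratedDeriv_ofReal (hδ.contDiff ψ), Complex.norm_real]
  induction n with
  | zero =>
    intro k hk
    obtain rfl : k = 0 := by omega
    simpa only [iteratedDeriv_zero] using h0.moderateOn
  | succ n ih =>
    intro k hk
    rcases Nat.lt_or_ge k (n + 1) with hk' | hk'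
    · exact ih k (by omega)
    obtain rfl : k = n + 1 := by omega
    rcases n with _ | n
    · refine BoundedOn.moderateOn ?_
      obtain ⟨p, hp⟩ := h.eventually_abs_deriv_le hδ hM hF
      refine ⟨p, fun φ hφ => ?_⟩
      obtain ⟨B, hB, H⟩ := hp φ hφ
      refine dominatedOn_iff.2 ⟨B + 1, by positivity, ?_⟩
      filter_upwards [H] with ε h1 t _
      rw [Real.rpow_zero, mul_one, zero_add, iteratedDeriv_one, Real.norm_eq_abs]
      linarith [h1 t]
    · have e : ∀ ψ, iteratedDeriv (n + 1 + 1) (x ψ) =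
          iteratedDeriv n fun t => F (x ψ t) * δ ψ t := fun ψ => by
        rw [iteratedDeriv_succ', iteratedDeriv_succ']
        exact congrArg (iteratedDeriv n) (funext fun t => h.eqn ψ t)
      simp only [e]
      exact moderateOn_iteratedDeriv_mul (fun φ => hF'.comp (h.contDiff φ)) hδ.contDiff
        (fun k hk => moderateOn_comp_of_le h.contDiff h0 n (fun j hj => ih j (by omega)) F hF' k hk)
        (fun k _ => hδm k)

end IsSolutionNet

variable {d : EM 𝕜} {δ : A0 𝕜 → ℝ → ℝ}

/-- The geodesic equation has a solution. -/
theorem IsDeltaNet.exists_isGeodesicNet (hδ : IsDeltaNet d δ) {f : ℝ → ℝ} (hf : ContDiff ℝ ∞ f)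
    (x₀ : ℝ) : ∃ (u : EM 𝕜) (x : A0 𝕜 → ℝ → ℝ), IsGeodesicNet f δ x₀ u x ∧
      IsLocallyBounded (cl u) := by
  have hf' : ContDiff ℝ ∞ (deriv f) := (contDiff_infty_iff_deriv.1 hf).2
  obtain ⟨F, M, hF, hFM, hFL, hFe⟩ := exists_cutoff (contDiff_const (c := (1 / 2 : ℝ)).mul hf') x₀
  choose x hx1 hx2 hx3 hx4 using fun φ : A0 𝕜 =>
    exists_solution hF (hδ.contDiff φ) hFM hFL (hδ.support φ) x₀
  have hx : IsSolutionNet F δ x₀ x := ⟨hx1, hx2, hx3, hx4⟩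
  let u : EM 𝕜 := ⟨fun φ t => (x φ t : ℂ), fun φ => Complex.ofRealCLM.contDiff.comp (hx1 φ),
    fun K hK k => by
      obtain ⟨T, hT⟩ := hK.isBounded.subset_closedBall 0
      rw [Real.closedBall_eq_Icc, zero_sub, zero_add] at hT
      obtain ⟨p, hp⟩ := hx.moderateOn hδ hF M.coe_nonneg hFM T k k le_rfl
      refine ⟨p, fun φ hφ => ?_⟩
      obtain ⟨c, hc, H⟩ := dominatedOn_iff.1 (hp φ hφ)
      refine dominatedOn_iff.2 ⟨c, hc, ?_⟩
      filter_upwards [H] with ε h1 t ht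
      rw [iteratedDeriv_ofReal (hx1 _), Complex.norm_real]
      exact h1 t (hT ht)⟩
  refine ⟨u, x, ⟨fun _ _ => rfl, hx1, hx2, hx3, ?_⟩, u, rfl, fun K hK => ?_⟩
  · obtain ⟨p, hp⟩ := hx.eventually_abs_deriv_le hδ M.coe_nonneg hFM
    obtain ⟨p', hp'⟩ := hδ.eventually
    refine ⟨p + p', fun φ hφ => ?_⟩
    obtain ⟨B, hB, H⟩ := hp φ (A_anti (by omega) hφ)
    obtain ⟨hs, -⟩ := hp' φ (A_anti (by omega) hφ)
    refine ⟨B, hB, ?_⟩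
    -- For ε below this threshold the displacement `3Bε` is less than 1, the radius on which the
    -- cut-off changes nothing. The summand 1 allows `B = 0`.
    have hr : 0 < 1 / (3 * (B + 1)) := by positivity
    filter_upwards [H, hs, eventually_pos_nhdsGT_zero,
      eventually_lt_nhdsGT_zero (r := 1 / 2) (by norm_num), eventually_lt_nhdsGT_zero hr] with
      ε h1 h2 e0 e1 e2
    have h3 : ∀ t < -ε, deriv (x (scale φ ε)) t = 0 := fun t ht => by
      rw [hx.deriv_eq]
      refine intervalIntegral.integral_zero_ae (Eventually.of_forall fun s hs => ?_)
      rw [h2 s (fun h => ?_), mul_zero]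
      have := hs.2.trans_lt (max_lt (by linarith : -1 < -ε) ht)
      linarith [h.1]
    -- The velocity is known to vanish strictly before `-ε`, so the reference time is `-2ε`; its
    -- distance to any point of `[-ε, ε]` is at most `3ε`.
    have h4 : x (scale φ ε) (-(2 * ε)) = x₀ := by
      have := (convex_Iio (-ε)).norm_image_sub_le_of_norm_deriv_le (f := x (scale φ ε)) (C := 0)
        (fun y _ => (hx1 _).differentiable (by simp) y) (fun y hy => by rw [h3 y hy, norm_zero])
        (x := -1) (y := -(2 * ε)) (by simp only [mem_Iio]; linarith)
        (by simp only [mem_Iio]; linarith)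
      rw [zero_mul, hx2] at this
      exact sub_eq_zero.1 (norm_le_zero_iff.1 this)
    have h5 : ∀ t ∈ Icc (-ε) ε, |x (scale φ ε) t - x₀| ≤ B * (3 * ε) := fun t ht => by
      have := hx.abs_sub_le h1 (-(2 * ε)) t
      rw [h4] at this
      refine this.trans (mul_le_mul_of_nonneg_left ?_ hB)
      rw [abs_le]
      constructor <;> linarith [ht.1, ht.2]
    refine ⟨h3, h1, h5, fun t => ?_⟩
    rw [hx4]
    -- On the support of `δ` the cut-off is inactive; off it both right-hand sides vanish.
    by_cases ht : t ∈ Icc (-ε) ε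
    · rw [hFe]
      refine (h5 t ht).trans ?_
      rw [lt_div_iff₀ (by positivity)] at e2
      nlinarith
    · rw [h2 t ht, mul_zero, mul_zero]
  · obtain ⟨T, hT⟩ := hK.isBounded.subset_closedBall 0
    rw [Real.closedBall_eq_Icc, zero_sub, zero_add] at hT
    obtain ⟨p, hp⟩ := hx.boundedOn hδ M.coe_nonneg hFM T
    refine ⟨p, fun φ hφ => ?_⟩
    obtain ⟨c, hc, H⟩ := dominatedOn_iff.1 (hp φ hφ)
    refine dominatedOn_iff.2 ⟨c, hc, ?_⟩
    filter_upwards [H] with ε h1 t ht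
    change ‖((x (scale φ ε) t : ℝ) : ℂ)‖ ≤ _
    rw [Complex.norm_real]
    exact h1 t (hT ht)

/-- The family need not solve the equation for every `φ`, but it does so exactly for `φ_ε` with ε
small, and that determines the class. -/
theorem IsGeodesicNet.isGeodesic (hδ : IsDeltaNet d δ) {f : ℝ → ℝ} (hf : ContDiff ℝ ∞ f)
    {x₀ : ℝ} {u : EM 𝕜} {x : A0 𝕜 → ℝ → ℝ} (h : IsGeodesicNet f δ x₀ u x)
    (hb : IsLocallyBounded (cl u)) : IsGeodesic f (cl d) x₀ (cl u) := by
  have hf' : ContDiff ℝ ∞ (deriv f) := (contDiff_infty_iff_deriv.1 hf).2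
  have hr : RealValued u := fun φ t => by rw [h.ofReal, Complex.ofReal_im]
  refine ⟨⟨u, rfl, hr⟩, hb, ?_, ?_, ?_⟩
  · rw [comp_cl hf' u hr hb, der_cl, der_cl, ← cl_mul, ← cl_smul]
    obtain ⟨p, hp⟩ := h.eventually
    refine cl_eq_of_eventually_eq p fun φ hφ => ?_
    obtain ⟨B, -, H⟩ := hp φ hφ
    filter_upwards [H] with ε h1
    funext t
    rw [h.derivEM_derivEM_apply, h1.2.2.2 t]
    change _ = (1 / 2 : ℂ) * (((deriv f (u.1 (scale φ ε) t).re : ℝ) : ℂ) * d.1 (scale φ ε) t)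
    rw [h.ofReal, hδ.ofReal, Complex.ofReal_re]
    push_cast
    ring
  · rw [pointValue_cl]
    have e : evalEM (-1) u = algebraMap ℂ (EMnum 𝕜) (x₀ : ℂ) := Subtype.ext <| funext fun φ => by
      rw [evalEM_apply, h.ofReal, h.init]; rfl
    rw [e]; rfl
  · rw [der_cl, pointValue_cl]
    have e : evalEM (-1) (derivEM u) = algebraMap ℂ (EMnum 𝕜) ((0 : ℝ) : ℂ) :=
      Subtype.ext <| funext fun φ => by
        rw [evalEM_apply, h.derivEM_apply, h.init']; rfl
    rw [e]; rfl

end Colombeau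

namespace Colombeau

variable {𝕜 : Type*} [RCLike 𝕜]

/-! ### The geodesic deviation equation -/

/-- The smooth function `1 + u` as a moderate family. -/
noncomputable def linEM (𝕜 : Type*) [RCLike 𝕜] : EM 𝕜 :=
  ⟨fun _ t => 1 + (t : ℂ), fun _ => contDiff_const.add Complex.ofRealCLM.contDiff,
    fun K hK k => by
      have hc : ContDiff ℝ ∞ fun t : ℝ => 1 + (t : ℂ) :=
        contDiff_const.add Complex.ofRealCLM.contDiff
      obtain ⟨C, hC⟩ := hK.exists_bound_of_continuousOn
        (hc.continuous_iteratedDeriv k (mod_cast le_top)).continuousOn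
      exact (moderateOn_const (C : ℂ)).mono fun _ t ht => by
        rw [Complex.norm_real]
        exact (hC t ht).trans (le_abs_self C)⟩

lemma der_linEM : der (cl (linEM 𝕜)) = 1 := by
  rw [der_cl]
  change cl _ = cl 1
  congr 1
  refine Subtype.ext <| funext fun φ => funext fun t => ?_
  change deriv (fun t : ℝ => 1 + (t : ℂ)) t = 1
  exact ((hasDerivAt_id t).ofReal_comp.const_add _).deriv

lemma pointValue_linEM : pointValue (cl (linEM 𝕜)) (-1) = 0 := by
  refine pointValue_eq_zero.2 ?_
  have e : evalEM (-1) (linEM 𝕜) = 0 := Subtype.ext <| funext fun φ => by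
    change 1 + ((-1 : ℝ) : ℂ) = 0
    simp
  rw [e]
  exact zero_mem _

/-- The family of Jacobi fields `a (1 + u) ∂_u X + b (1 + u) ∂_v` along the geodesic `X`. -/
noncomputable def deviationField (f : ℝ → ℝ) (D X : G 𝕜) (a b : ℝ) : FourVector (G 𝕜) where
  u := algebraMap ℂ (G 𝕜) a * cl (linEM 𝕜)
  v := algebraMap ℂ (G 𝕜) b * cl (linEM 𝕜) +
    algebraMap ℂ (G 𝕜) a * (cl (linEM 𝕜) * (comp f X * D + der X * der X))
  x := algebraMap ℂ (G 𝕜) a * (cl (linEM 𝕜) * der X)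
  y := 0

/-- Turns scalars into ring elements with zero derivative, the form in which the identities in a
differential ring apply. -/
lemma smul_eq_algebraMap_mul (c : ℂ) (X : G 𝕜) : c • X = algebraMap ℂ (G 𝕜) c * X := by
  obtain ⟨u, rfl⟩ := cl_surjective X
  rfl

lemma der_zero : der (0 : G 𝕜) = 0 := by
  simpa only [map_zero] using der_algebraMap (𝕜 := 𝕜) 0

lemma der_one : der (1 : G 𝕜) = 0 := by
  simpa only [map_one] using der_algebraMap (𝕜 := 𝕜) 1

lemma pointValue_zero (t : ℝ) : pointValue (0 : G 𝕜) t = 0 := by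
  simpa only [map_zero] using pointValue_algebraMap (𝕜 := 𝕜) 0 t

lemma isLocallyBounded_zero : IsLocallyBounded (0 : G 𝕜) :=
  ⟨0, rfl, fun _ _ => negligibleOn_zero.boundedOn⟩

lemma IsLocallyBounded.smul {X : G 𝕜} (h : IsLocallyBounded X) (c : ℂ) :
    IsLocallyBounded (c • X) := by
  obtain ⟨u, rfl, hu⟩ := h
  refine ⟨c • u, rfl, fun K hK => ?_⟩
  obtain ⟨p, hp⟩ := hu K hK
  refine ⟨p, fun φ hφ => ?_⟩
  have h1 := (dominatedOn_const (K := K) (φ := φ) c).mul (hp φ hφ)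
  rw [zero_add] at h1
  exact h1

variable {d : EM 𝕜} {δ : A0 𝕜 → ℝ → ℝ} {f : ℝ → ℝ} {x₀ : ℝ} {X : G 𝕜}

/-! ### Jacobi field identities in a commutative ring with a derivation. -/

section differentialRing

variable {R : Type*} [CommRing R] {h a b l g f₀ f₁ f₂ x : R}

/-- The second derivative of the geodesic equation `2 ẍ = f₁ g`, in a differential ring. -/
lemma jacobi_aux (D : R → R) (hmul : ∀ x y, D (x * y) = D x * y + x * D y) (h2 : 2 * h = 1)
    (hh : D h = 0) (hx : D (D x) = h * (f₁ * g)) :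
    f₁ * g = 2 * D (D x) ∧ D f₁ * g + f₁ * D g = 2 * D (D (D x)) := by
  have e : D (D (D x)) = h * (D f₁ * g + f₁ * D g) := by
    rw [hx, hmul, hmul, hh]; ring
  constructor
  · linear_combination (-(f₁ * g)) * h2 - 2 * hx
  · linear_combination (-(D f₁ * g + f₁ * D g)) * h2 - 2 * e

/-- Here `l` stands for `1 + u`, `g` for the delta function and `h` for ½. Both sides equal `a (2ẍ +
l x⃛)`: on the right, `f₁ g = 2ẍ`, and the terms with `f₂` and with the derivative of `g` combine to
the derivative of `½ f₁ g`. -/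
lemma jacobi_x (D : R → R) (hadd : ∀ x y, D (x + y) = D x + D y)
    (hmul : ∀ x y, D (x * y) = D x * y + x * D y) (h2 : 2 * h = 1) (hh : D h = 0)
    (ha : D a = 0) (h0 : D 0 = 0) (h1 : D 1 = 0) (hl : D l = 1)
    (hf₁ : D f₁ = f₂ * D x) (hx : D (D x) = h * (f₁ * g)) :
    D (D (a * (l * D x))) =
      (D (a * l) * f₁ + h * (a * (l * D x) * f₂)) * g + h * (f₁ * (a * l) * D g) := by
  obtain ⟨e1, e2⟩ := jacobi_aux D hmul h2 hh hx
  rw [hf₁] at e2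
  simp only [hadd, hmul, ha, hl, h0, h1]
  linear_combination (-a) * e1 - h * a * l * e2 - a * l * D (D (D x)) * h2

/-- The second derivative of `a l f₀ g` occurs on both sides and cancels, so no chain rule for `f₀`
is needed. After substituting `f₁ g = 2ẍ` and its derivative, what remains on the right is `a (4 ẋ ẍ
+ 2 l ẍ² + 2 l ẋ x⃛)`, the second derivative of `a l ẋ²`. -/
lemma jacobi_v (D : R → R) (hadd : ∀ x y, D (x + y) = D x + D y)
    (hmul : ∀ x y, D (x * y) = D x * y + x * D y) (h2 : 2 * h = 1) (hh : D h = 0)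
    (ha : D a = 0) (hb : D b = 0) (h0 : D 0 = 0)
    (h1 : D 1 = 0) (hl : D l = 1) (hf₁ : D f₁ = f₂ * D x) (hx : D (D x) = h * (f₁ * g)) :
    D (D (b * l + a * (l * (f₀ * g + D x * D x)))) =
      2 * D (a * (l * D x) * f₁ * g) - a * (l * D x) * f₁ * D g + D (D (a * l * f₀ * g))
        - a * l * f₂ * D x ^ 2 * g - a * l * f₁ * D (D x) * g := by
  obtain ⟨e1, e2⟩ := jacobi_aux D hmul h2 hh hx
  rw [hf₁] at e2
  simp only [hadd, hmul, ha, hb, hl, h0, h1, hf₁]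
  linear_combination (-(2 * a * D x + a * l * D (D x))) * e1 - a * l * D x * e2

end differentialRing

lemma der_algebraMap_mul (c : ℂ) (Y : G 𝕜) :
    der (algebraMap ℂ (G 𝕜) c * Y) = algebraMap ℂ (G 𝕜) c * der Y := by
  rw [der_mul, der_algebraMap, zero_mul, zero_add]

lemma pointValue_algebraMap_mul (c : ℂ) (Y : G 𝕜) (t : ℝ) :
    pointValue (algebraMap ℂ (G 𝕜) c * Y) t = algebraMap ℂ (GNum 𝕜) c * pointValue Y t := by
  rw [pointValue_mul, pointValue_algebraMap]

lemma pointValue_linEM_mul (Y : G 𝕜) : pointValue (cl (linEM 𝕜) * Y) (-1) = 0 := by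
  rw [pointValue_mul, pointValue_linEM, zero_mul]

lemma pointValue_der_linEM_mul (Y : G 𝕜) :
    pointValue (der (cl (linEM 𝕜) * Y)) (-1) = pointValue Y (-1) := by
  rw [der_mul, der_linEM, one_mul, pointValue_add, pointValue_linEM_mul, add_zero]

lemma realNum_zero : realNum 𝕜 0 = 0 := by rw [realNum, Complex.ofReal_zero, map_zero]

/-- The explicit Jacobi fields solve the geodesic deviation equation. -/
theorem isDeviation_deviationField (hδ : IsDeltaNet d δ) (hf : ContDiff ℝ ∞ f)
    (hX : IsGeodesic f (cl d) x₀ X) (a b : ℝ) :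
    IsDeviation f (cl d) X ⟨0, 0, 0, 0⟩ ⟨a, b, 0, 0⟩ (deviationField f (cl d) X a b) := by
  have hf' : ContDiff ℝ ∞ (deriv f) := (contDiff_infty_iff_deriv.1 hf).2
  have c1 := der_comp hf' hX.real hX.locallyBounded
  have h2 : 2 * algebraMap ℂ (G 𝕜) (1 / 2) = 1 := by
    rw [← map_ofNat (algebraMap ℂ (G 𝕜)) 2, ← map_mul]
    norm_num
  have hd := hδ.pointValue_eq_zero
  have e1 := hX.eqn
  rw [smul_eq_algebraMap_mul] at e1
  have i1 : pointValue (der X) (-1) = 0 := hX.init'.trans realNum_zero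
  -- The `v`-component of the tangent vanishes at `-1`, so the initial velocity of `N^v` is `b`
  -- alone.
  have i2 : pointValue (comp f X * cl d + der X * der X) (-1) = 0 := by
    rw [pointValue_add, pointValue_mul, pointValue_mul, hd, i1, mul_zero, mul_zero, add_zero]
  have dl : ∀ c : ℂ, der (algebraMap ℂ (G 𝕜) c * cl (linEM 𝕜)) = algebraMap ℂ (G 𝕜) c :=
    fun c => by rw [der_algebraMap_mul, der_linEM, mul_one]
  constructor
  · exact jacobi_v (R := G 𝕜) der der_add der_mul h2 (der_algebraMap _) (der_algebraMap _)
      (der_algebraMap _) der_zero der_one der_linEM c1 e1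
  · rw [smul_eq_algebraMap_mul, smul_eq_algebraMap_mul]
    exact jacobi_x (R := G 𝕜) der der_add der_mul h2 (der_algebraMap _) (der_algebraMap _)
      der_zero der_one der_linEM c1 e1
  · exact (congrArg der der_zero).trans der_zero
  · exact (congrArg der (dl _)).trans (der_algebraMap _)
  · rw [realNum_zero, deviationField, pointValue_algebraMap_mul, pointValue_linEM, mul_zero]
  · rw [realNum_zero, deviationField, pointValue_add, pointValue_algebraMap_mul, pointValue_linEM,
      pointValue_algebraMap_mul, pointValue_linEM_mul, mul_zero, mul_zero, add_zero]
  · rw [realNum_zero, deviationField, pointValue_algebraMap_mul, pointValue_linEM_mul, mul_zero]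
  · rw [realNum_zero, deviationField, pointValue_zero]
  · rw [deviationField, dl, pointValue_algebraMap]; rfl
  · rw [deviationField, der_add, dl, der_algebraMap_mul, pointValue_add, pointValue_algebraMap,
      pointValue_algebraMap_mul, pointValue_der_linEM_mul, i2, mul_zero, add_zero]; rfl
  · rw [realNum_zero, deviationField, der_algebraMap_mul, pointValue_algebraMap_mul,
      pointValue_der_linEM_mul, i1, mul_zero]
  · rw [realNum_zero, deviationField, der_zero, pointValue_zero]

/-- A generalized function is determined by its second derivative and its initial data. -/
lemma eq_of_der_der_eq (hδ : IsDeltaNet d δ) {Y Z : G 𝕜} (h : der (der Y) = der (der Z))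
    (h0 : pointValue Y (-1) = pointValue Z (-1))
    (h1 : pointValue (der Y) (-1) = pointValue (der Z) (-1)) : Y = Z := by
  refine sub_eq_zero.1 (hδ.eq_zero_of_der_der_eq isLocallyBounded_zero ?_ ?_ ?_)
  · rw [der_sub, der_sub, h, sub_self, zero_mul, zero_mul]
  · rw [pointValue_sub, h0, sub_self]
  · rw [der_sub, pointValue_sub, h1, sub_self]

/-- With `N^u` fixed, the right-hand side of the `x`-equation is affine in `N^x`, and the term with
the derivative of the delta function drops out of differences. What is left is a linear equation
with coefficient `½ f''(X) D`. -/
lemma sub_eq_mul_sub_mul {R : Type*} [CommRing R] (y z c g h k e : R) :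
    (c + h * (y * k)) * g + e - ((c + h * (z * k)) * g + e) = h * k * (y - z) * g := by
  ring

/-- Uniqueness for the geodesic deviation equation. -/
theorem isDeviation_unique (hδ : IsDeltaNet d δ) (hf : ContDiff ℝ ∞ f)
    (hX : IsGeodesic f (cl d) x₀ X) {n n' : FourVector ℝ} {Y Z : FourVector (G 𝕜)}
    (hY : IsDeviation f (cl d) X n n' Y) (hZ : IsDeviation f (cl d) X n n' Z) : Y = Z := by
  have hf' : ContDiff ℝ ∞ (deriv f) := (contDiff_infty_iff_deriv.1 hf).2
  have hf'' : ContDiff ℝ ∞ (deriv (deriv f)) := (contDiff_infty_iff_deriv.1 hf').2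
  -- The system is triangular: `N^u` and `N^y` first, then `N^x` given `N^u`, and finally `N^v`,
  -- whose second derivative depends on `N^u` and `N^x` only.
  have eu : Y.u = Z.u := eq_of_der_der_eq hδ (hY.eqn_u.trans hZ.eqn_u.symm)
    (hY.init_u.trans hZ.init_u.symm) (hY.init_u'.trans hZ.init_u'.symm)
  have ey : Y.y = Z.y := eq_of_der_der_eq hδ (hY.eqn_y.trans hZ.eqn_y.symm)
    (hY.init_y.trans hZ.init_y.symm) (hY.init_y'.trans hZ.init_y'.symm)
  have ex : Y.x = Z.x := by
    refine sub_eq_zero.1 (hδ.eq_zero_of_der_der_eq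
      (B := (1 / 2 : ℂ) • comp (deriv (deriv f)) X)
      ((isLocallyBounded_comp hf'' hX.real hX.locallyBounded).smul _) ?_ ?_ ?_)
    · rw [der_sub, der_sub, hY.eqn_x, hZ.eqn_x, eu]
      simp only [smul_eq_algebraMap_mul]
      exact sub_eq_mul_sub_mul (R := G 𝕜) _ _ _ _ _ _ _
    · rw [pointValue_sub, hY.init_x, hZ.init_x, sub_self]
    · rw [der_sub, pointValue_sub, hY.init_x', hZ.init_x', sub_self]
  have ev : Y.v = Z.v := by
    refine eq_of_der_der_eq hδ ?_ (hY.init_v.trans hZ.init_v.symm)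
      (hY.init_v'.trans hZ.init_v'.symm)
    rw [hY.eqn_v, hZ.eqn_v, eu, ex]
  exact FourVector.ext eu ev ex ey

end Colombeau

namespace Colombeau

variable {𝕜 : Type*} [RCLike 𝕜]

/-! ### Associated distributions -/

section association

variable {d u : EM 𝕜} {δ x : A0 𝕜 → ℝ → ℝ} {f : ℝ → ℝ} {x₀ : ℝ}

/-- Delta nets converge to the Dirac measure, also when tested against families of functions that
converge uniformly on the shrinking supports. -/
lemma IsDeltaNet.tendsto_integral_mul (hδ : IsDeltaNet d δ) : ∃ p : ℕ, ∀ φ ∈ A 𝕜 p,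
    ∀ (g : ℝ → ℝ → ℝ) (g₀ : ℝ), (∀ ε, Continuous (g ε)) →
      (∀ r > 0, ∀ᶠ ε in 𝓝[>] (0 : ℝ), ∀ t ∈ Icc (-ε) ε, |g ε t - g₀| ≤ r) →
      Tendsto (fun ε => ∫ t, g ε t * δ (scale φ ε) t) (𝓝[>] 0) (𝓝 g₀) := by
  obtain ⟨p, hp⟩ := hδ.eventually
  refine ⟨p, fun φ hφ g g₀ hg h => ?_⟩
  obtain ⟨hs, ⟨C, hC, hb⟩, ht⟩ := hp φ hφ
  have hi : ∀ k : ℝ → ℝ, Continuous k → ∀ ψ : A0 𝕜, Integrable fun t => k t * δ ψ t :=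
    fun k hk ψ => (hk.mul (hδ.contDiff ψ).continuous).integrable_of_hasCompactSupport
      (HasCompactSupport.intro isCompact_Icc fun t ht => by
        rw [Pi.mul_apply, hδ.support ψ t ht, mul_zero])
  -- Split `g = (g - g₀) + g₀`. The first part is uniformly small on the supports and is integrated
  -- against a family bounded by `C` in `L¹`; the second uses only that the integrals tend to 1.
  have h1 : Tendsto (fun ε => ∫ t, (g ε t - g₀) * δ (scale φ ε) t) (𝓝[>] 0) (𝓝 0) := by
    rw [Metric.tendsto_nhds]
    intro r hr
    have hr' : 0 < r / (2 * C) := by positivity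
    filter_upwards [h _ hr', hs, hb] with ε e1 e2 e3
    rw [dist_zero_right]
    calc ‖∫ t, (g ε t - g₀) * δ (scale φ ε) t‖
        ≤ ∫ t, r / (2 * C) * |δ (scale φ ε) t| := by
          refine norm_integral_le_of_norm_le ((hδ.integrable _).abs.const_mul _)
            (Eventually.of_forall fun t => ?_)
          rw [norm_mul, Real.norm_eq_abs, Real.norm_eq_abs]
          by_cases ht : t ∈ Icc (-ε) ε
          · exact mul_le_mul_of_nonneg_right (e1 t ht) (abs_nonneg _)
          · rw [e2 t ht, abs_zero, mul_zero, mul_zero]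
      _ ≤ r / (2 * C) * C := by
          rw [integral_const_mul]
          gcongr
      _ < r := by
          field_simp
          linarith
  have h2 := h1.add (ht.const_mul g₀)
  rw [zero_add, mul_one] at h2
  refine h2.congr fun ε => ?_
  rw [← integral_const_mul, ← integral_add]
  · exact integral_congr_ae (Eventually.of_forall fun t => by ring)
  · exact hi _ ((hg ε).sub continuous_const) _
  · exact (hδ.integrable _).const_mul _

/-- The velocity of a geodesic jumps at the support of the delta function. -/
lemma IsGeodesicNet.tendsto_deriv (h : IsGeodesicNet f δ x₀ u x) (hδ : IsDeltaNet d δ)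
    (hf : ContDiff ℝ ∞ f) : ∃ p : ℕ, ∀ φ ∈ A 𝕜 p,
      (∃ B : ℝ, ∀ᶠ ε in 𝓝[>] (0 : ℝ), ∀ t, |deriv (x (scale φ ε)) t| ≤ B) ∧
      (∀ t < 0, Tendsto (fun ε => deriv (x (scale φ ε)) t) (𝓝[>] 0) (𝓝 0)) ∧
      (∀ t > 0, Tendsto (fun ε => deriv (x (scale φ ε)) t) (𝓝[>] 0)
        (𝓝 (1 / 2 * deriv f x₀))) ∧
      ∀ k : ℝ → ℝ, Continuous k → ∀ r > 0, ∀ᶠ ε in 𝓝[>] (0 : ℝ), ∀ t ∈ Icc (-ε) ε,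
        |k (x (scale φ ε) t) - k x₀| ≤ r := by
  have hf' : ContDiff ℝ ∞ (deriv f) := (contDiff_infty_iff_deriv.1 hf).2
  obtain ⟨p, hp⟩ := h.eventually
  obtain ⟨p', hp'⟩ := hδ.eventually
  obtain ⟨p'', hp''⟩ := hδ.tendsto_integral_mul
  refine ⟨p + p' + p'', fun φ hφ => ?_⟩
  obtain ⟨B, hB, H⟩ := hp φ (A_anti (by omega) hφ)
  obtain ⟨hs, -⟩ := hp' φ (A_anti (by omega) hφ)
  have hk : ∀ k : ℝ → ℝ, Continuous k → ∀ r > 0, ∀ᶠ ε in 𝓝[>] (0 : ℝ), ∀ t ∈ Icc (-ε) ε,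
      |k (x (scale φ ε) t) - k x₀| ≤ r := fun k hk r hr => by
    obtain ⟨s, hs, hks⟩ := Metric.continuousAt_iff.1 hk.continuousAt r hr
    have hs' : 0 < s / (3 * (B + 1)) := by positivity
    filter_upwards [H, eventually_pos_nhdsGT_zero, eventually_lt_nhdsGT_zero hs'] with ε e1 e2 e3
      t ht
    have e4 := e1.2.2.1 t ht
    rw [lt_div_iff₀ (by positivity)] at e3
    exact (hks (by rw [Real.dist_eq]; nlinarith)).le
  refine ⟨⟨B, H.mono fun ε e => e.2.1⟩, fun t ht => ?_, fun t ht => ?_, hk⟩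
  · refine tendsto_const_nhds.congr' ?_
    filter_upwards [H, eventually_lt_nhdsGT_zero (neg_pos.2 ht)] with ε e1 e2
    exact (e1.1 t (by linarith)).symm
  -- For `ε < t` and `ε < 1` the whole support lies in `(-1, t]`, so the velocity at `t` is the
  -- integral of `½ f'(x) δ` over the line.
  · refine (hp'' φ (A_anti (by omega) hφ)
      (fun ε s => 1 / 2 * deriv f (x (scale φ ε) s)) _
      (fun ε => continuous_const.mul (hf'.continuous.comp (h.contDiff _).continuous))
      (hk (fun y => 1 / 2 * deriv f y) (continuous_const.mul hf'.continuous))).congr' ?_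
    filter_upwards [H, hs, eventually_lt_nhdsGT_zero ht, eventually_lt_nhdsGT_zero one_pos]
      with ε e1 e2 e3 e4
    have hc : ContDiff ℝ ∞ (deriv (x (scale φ ε))) :=
      (contDiff_infty_iff_deriv.1 (h.contDiff _)).2
    have h1 := intervalIntegral.integral_deriv_eq_sub (f := deriv (x (scale φ ε)))
      (a := -1) (b := t) (fun s _ => hc.differentiable (by simp) s)
      ((contDiff_infty_iff_deriv.1 hc).2.continuous.intervalIntegrable _ _)
    rw [h.init', sub_zero, intervalIntegral.integral_eq_integral_of_support_subset] at h1
    · rw [← h1]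
      exact integral_congr_ae (Eventually.of_forall fun s => (e1.2.2.2 s).symm)
    · intro s hs
      by_contra hs'
      refine hs ?_
      rw [e1.2.2.2, e2 s (fun hm => hs' ⟨by linarith [hm.1], by linarith [hm.2]⟩), mul_zero]

lemma testFunction_integrable_smul (ψ : 𝓓((⊤ : Opens ℝ), ℝ)) {g : ℝ → ℂ}
    (hg : LocallyIntegrable g) : Integrable fun t => ψ t • g t :=
  hg.integrable_smul_left_of_hasCompactSupport ψ.contDiff.continuous ψ.hasCompactSupport

/-- Families that converge boundedly to a multiple of the Heaviside function. -/
lemma tendsto_integral_heaviside (ψ : 𝓓((⊤ : Opens ℝ), ℝ)) {g : ℝ → ℝ → ℂ} {B : ℝ} {c : ℂ}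
    (hg : ∀ ε, Continuous (g ε)) (hB : ∀ᶠ ε in 𝓝[>] (0 : ℝ), ∀ t, ‖g ε t‖ ≤ B)
    (h0 : ∀ t < 0, Tendsto (fun ε => g ε t) (𝓝[>] 0) (𝓝 0))
    (h1 : ∀ t > 0, Tendsto (fun ε => g ε t) (𝓝[>] 0) (𝓝 c)) :
    Tendsto (fun ε => ∫ t, ψ t • ((1 + (t : ℂ)) * g ε t)) (𝓝[>] 0)
      (𝓝 (c * (heaviside ψ + uPlus ψ))) := by
  have hl : Continuous fun t : ℝ => 1 + (t : ℂ) := by fun_prop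
  -- This is `(1 + u) θ = θ + u₊`.
  have e : c * (heaviside ψ + uPlus ψ) =
      ∫ t, ψ t • ((1 + (t : ℂ)) * if 0 < t then c else 0) := by
    rw [heaviside_apply, uPlus_apply, ← integral_add, ← integral_const_mul]
    · refine integral_congr_ae (Eventually.of_forall fun t => ?_)
      simp only [Complex.real_smul]
      split_ifs with ht
      · rw [max_eq_left ht.le]; ring
      · rw [max_eq_right (not_lt.1 ht)]; simp
    · exact testFunction_integrable_smul ψ
        ((locallyIntegrable_const (1 : ℂ)).indicator measurableSet_Ioi)
    · exact testFunction_integrable_smul ψ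
        (by fun_prop : Continuous fun u : ℝ => ((max u 0 : ℝ) : ℂ)).locallyIntegrable
  rw [e]
  refine tendsto_integral_filter_of_dominated_convergence
    (fun t => ‖ψ t • (1 + (t : ℂ))‖ * B) ?_ ?_ ?_ ?_
  · exact Eventually.of_forall fun ε =>
      (ψ.contDiff.continuous.smul (hl.mul (hg ε))).aestronglyMeasurable
  · filter_upwards [hB] with ε h
    refine Eventually.of_forall fun t => ?_
    rw [← smul_mul_assoc, norm_mul]
    exact mul_le_mul_of_nonneg_left (h t) (norm_nonneg _)
  · exact (testFunction_integrable_smul ψ hl.locallyIntegrable).norm.mul_const B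
  -- Nothing is assumed about the limit at the origin, which is a null set.
  · have h3 : ∀ᵐ t : ℝ, t ≠ 0 := by simp [ae_iff, measure_singleton]
    filter_upwards [h3] with t ht
    refine Tendsto.const_smul (Tendsto.const_mul _ ?_) _
    rcases lt_or_gt_of_ne ht with h | h
    · rw [if_neg h.not_gt]; exact h0 t h
    · rw [if_pos h]; exact h1 t h

/-- The distribution associated to the component `N^x`. -/
theorem IsGeodesicNet.associated_x (h : IsGeodesicNet f δ x₀ u x) (hδ : IsDeltaNet d δ)
    (hf : ContDiff ℝ ∞ f) (a b : ℝ) :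
    Associated (deviationField f (cl d) (cl u) a b).x
      ((1 / 2 * a * deriv f x₀) • (uPlus + heaviside)) := by
  obtain ⟨p, hp⟩ := h.tendsto_deriv hδ hf
  refine ⟨algebraMap ℂ (EM 𝕜) a * (linEM 𝕜 * derivEM u), rfl, p, fun φ hφ ψ => ?_⟩
  obtain ⟨⟨B, hB⟩, h0, h1, -⟩ := hp φ hφ
  have hc : ∀ ε, Continuous fun t => ((deriv (x (scale φ ε)) t : ℝ) : ℂ) := fun ε =>
    Complex.continuous_ofReal.comp (contDiff_infty_iff_deriv.1 (h.contDiff _)).2.continuous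
  have key := tendsto_integral_heaviside ψ (B := |a| * B)
    (g := fun ε t => (a : ℂ) * ((deriv (x (scale φ ε)) t : ℝ) : ℂ))
    (fun ε => continuous_const.mul (hc ε))
    (by
      filter_upwards [hB] with ε e t
      rw [norm_mul, Complex.norm_real, Complex.norm_real]
      exact mul_le_mul_of_nonneg_left (e t) (abs_nonneg a))
    (fun t ht => by
      simpa using (((Complex.continuous_ofReal.tendsto _).comp (h0 t ht)).const_mul (a : ℂ)))
    (fun t ht => (((Complex.continuous_ofReal.tendsto _).comp (h1 t ht)).const_mul (a : ℂ)))
  convert key using 1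
  · funext ε
    refine integral_congr_ae (Eventually.of_forall fun t => ?_)
    change ψ t • ((a : ℂ) * ((1 + (t : ℂ)) * (derivEM u).1 (scale φ ε) t)) = _
    rw [h.derivEM_apply, mul_left_comm]
  · congr 1
    change (1 / 2 * a * deriv f x₀) • (uPlus ψ + heaviside ψ) = _
    rw [Complex.real_smul]
    push_cast
    ring

/-- The distribution associated to the component `N^v`. -/
theorem IsGeodesicNet.associated_v (h : IsGeodesicNet f δ x₀ u x) (hδ : IsDeltaNet d δ)
    (hf : ContDiff ℝ ∞ f) (hb : IsLocallyBounded (cl u)) (a b : ℝ) :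
    Associated (deviationField f (cl d) (cl u) a b).v
      (b • onePlus + a • (f x₀ • diracDelta +
        (1 / 4 * deriv f x₀ ^ 2) • (heaviside + uPlus))) := by
  obtain ⟨p, hp⟩ := h.tendsto_deriv hδ hf
  obtain ⟨p', hp'⟩ := hδ.tendsto_integral_mul
  have hr : RealValued u := fun φ t => by rw [h.ofReal, Complex.ofReal_im]
  refine ⟨algebraMap ℂ (EM 𝕜) b * linEM 𝕜 + algebraMap ℂ (EM 𝕜) a *
    (linEM 𝕜 * (compEM f hf u hb * d + derivEM u * derivEM u)), ?_, p + p', fun φ hφ ψ => ?_⟩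
  · rw [deviationField, comp_cl hf u hr hb]; rfl
  obtain ⟨⟨B, hB⟩, h0, h1, hk⟩ := hp φ (A_anti (by omega) hφ)
  have hψ := ψ.contDiff.continuous
  have hc : ∀ ε, Continuous fun t => ((deriv (x (scale φ ε)) t : ℝ) : ℂ) := fun ε =>
    Complex.continuous_ofReal.comp (contDiff_infty_iff_deriv.1 (h.contDiff _)).2.continuous
  have hfx : ∀ ε, Continuous fun t => f (x (scale φ ε) t) := fun ε =>
    hf.continuous.comp (h.contDiff _).continuous
  -- Association alone would not pass to squares; bounded pointwise convergence does, and gives the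
  -- jump `(½ f'(x₀))²`.
  have sq := tendsto_integral_heaviside ψ (B := |a| * (B * B))
    (g := fun ε t => (a : ℂ) * (((deriv (x (scale φ ε)) t : ℝ) : ℂ) *
      ((deriv (x (scale φ ε)) t : ℝ) : ℂ)))
    (fun ε => continuous_const.mul ((hc ε).mul (hc ε)))
    (by
      filter_upwards [hB] with ε e t
      rw [norm_mul, norm_mul, Complex.norm_real, Complex.norm_real]
      exact mul_le_mul_of_nonneg_left (mul_le_mul (e t) (e t) (abs_nonneg _)
        ((abs_nonneg _).trans (e t))) (abs_nonneg a))
    (fun t ht => by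
      have e := (Complex.continuous_ofReal.tendsto _).comp (h0 t ht)
      simpa using (e.mul e).const_mul (a : ℂ))
    (fun t ht => by
      have e := (Complex.continuous_ofReal.tendsto _).comp (h1 t ht)
      exact (e.mul e).const_mul (a : ℂ))
  -- The test function, the factor `1 + t` and `f(x)` are all absorbed into the family tested
  -- against the delta net. It is a fixed continuous function of `(t, x)`, evaluated at points
  -- tending to `(0, x₀)` uniformly on the supports.
  have dl := hp' φ (A_anti (by omega) hφ)
    (fun ε t => a * (ψ t * ((1 + t) * f (x (scale φ ε) t)))) (a * (ψ 0 * ((1 + 0) * f x₀)))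
    (fun ε => continuous_const.mul (hψ.mul ((continuous_const.add continuous_id).mul (hfx ε))))
    (fun r hr => by
      have hK : Continuous fun q : ℝ × ℝ => a * (ψ q.1 * ((1 + q.1) * f q.2)) :=
        continuous_const.mul ((hψ.comp continuous_fst).mul
          ((continuous_const.add continuous_fst).mul (hf.continuous.comp continuous_snd)))
      obtain ⟨s, hs, hKs⟩ := Metric.continuousAt_iff.1 (hK.continuousAt (x := (0, x₀))) r hr
      filter_upwards [hk id continuous_id (s / 2) (half_pos hs), eventually_lt_nhdsGT_zero hs]
        with ε e1 e2 t ht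
      refine (hKs (x := (t, x (scale φ ε) t)) (max_lt ?_ ?_)).le
      · rw [Real.dist_eq, sub_zero]
        exact (abs_le.2 ht).trans_lt e2
      · exact (e1 t ht).trans_lt (half_lt_self hs))
  have dl' := (Complex.continuous_ofReal.tendsto _).comp dl
  have key := ((tendsto_const_nhds (x := (b : ℂ) * onePlus ψ)).add dl').add sq
  convert key using 1
  · funext ε
    have hl : Continuous fun t : ℝ => 1 + (t : ℂ) := by fun_prop
    have hfc : Continuous fun t => ((f (x (scale φ ε) t) : ℝ) : ℂ) :=
      Complex.continuous_ofReal.comp (hfx ε)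
    have hdc : Continuous fun t => ((δ (scale φ ε) t : ℝ) : ℂ) :=
      Complex.continuous_ofReal.comp (hδ.contDiff _).continuous
    have hcε := hc ε
    rw [Function.comp_apply, ← integral_complex_ofReal, onePlus_apply, ← integral_const_mul,
      ← integral_add, ← integral_add]
    · refine integral_congr_ae (Eventually.of_forall fun t => ?_)
      change ψ t • ((b : ℂ) * (1 + (t : ℂ)) + (a : ℂ) * ((1 + (t : ℂ)) *
        (((f (u.1 (scale φ ε) t).re : ℝ) : ℂ) * d.1 (scale φ ε) t +
          (derivEM u).1 (scale φ ε) t * (derivEM u).1 (scale φ ε) t))) = _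
      rw [h.derivEM_apply, h.ofReal, hδ.ofReal, Complex.ofReal_re]
      simp only [Complex.real_smul]
      push_cast
      ring
    · refine (testFunction_integrable_smul ψ (hl.locallyIntegrable)).const_mul _ |>.add ?_
      have := testFunction_integrable_smul ψ (Continuous.locallyIntegrable
        (f := fun t : ℝ => (a : ℂ) * ((1 + (t : ℂ)) * ((f (x (scale φ ε) t) : ℝ) : ℂ)) *
          ((δ (scale φ ε) t : ℝ) : ℂ)) (by fun_prop))
      refine this.congr (Eventually.of_forall fun t => ?_)
      simp only [Complex.real_smul]
      push_cast
      ring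
    · exact testFunction_integrable_smul ψ (Continuous.locallyIntegrable (by fun_prop))
    · exact (testFunction_integrable_smul ψ (hl.locallyIntegrable)).const_mul _
    · have := testFunction_integrable_smul ψ (Continuous.locallyIntegrable
        (f := fun t : ℝ => (a : ℂ) * ((1 + (t : ℂ)) * ((f (x (scale φ ε) t) : ℝ) : ℂ)) *
          ((δ (scale φ ε) t : ℝ) : ℂ)) (by fun_prop))
      refine this.congr (Eventually.of_forall fun t => ?_)
      simp only [Complex.real_smul]
      push_cast
      ring
  · congr 1
    change b • onePlus ψ + a • (f x₀ • ((ψ 0 : ℝ) : ℂ) +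
      (1 / 4 * deriv f x₀ ^ 2) • (heaviside ψ + uPlus ψ)) = _
    simp only [Complex.real_smul]
    push_cast
    ring

end association

end Colombeau

theorem theorem4 (𝕜 : Type*) [RCLike 𝕜] (f : ℝ → ℝ) (hf : ContDiff ℝ ∞ f)
    (D : Colombeau.G 𝕜) (hD : Colombeau.IsGeneralizedDelta D) (hD_real : Colombeau.IsReal D)
    (x₀ a b : ℝ) :
    (∃! X : Colombeau.G 𝕜, Colombeau.IsGeodesic f D x₀ X) ∧
    ∀ X : Colombeau.G 𝕜, Colombeau.IsGeodesic f D x₀ X →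
      (∃! Nf : Colombeau.FourVector (Colombeau.G 𝕜),
        Colombeau.IsDeviation f D X ⟨0, 0, 0, 0⟩ ⟨a, b, 0, 0⟩ Nf) ∧
      ∀ Nf : Colombeau.FourVector (Colombeau.G 𝕜),
        Colombeau.IsDeviation f D X ⟨0, 0, 0, 0⟩ ⟨a, b, 0, 0⟩ Nf →
        Colombeau.Associated Nf.x
          ((1 / 2 * a * deriv f x₀) • (Colombeau.uPlus + Colombeau.heaviside)) ∧
        Colombeau.Associated Nf.v
          (b • Colombeau.onePlus + a • (f x₀ • Colombeau.diracDelta +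
            (1 / 4 * deriv f x₀ ^ 2) • (Colombeau.heaviside + Colombeau.uPlus))) := by
  obtain ⟨d, δ, rfl, hδ⟩ := hD.exists_isDeltaNet hD_real
  obtain ⟨u, x, hux, hb⟩ := hδ.exists_isGeodesicNet hf x₀
  have hu := hux.isGeodesic hδ hf hb
  refine ⟨⟨Colombeau.cl u, hu, fun Y hY => hδ.isGeodesic_unique hf hY hu⟩, fun X hX => ?_⟩
  -- By uniqueness an arbitrary solution is the constructed one, and likewise for the deviation
  -- field. Association asks for one suitable representative, so it may be checked on the explicit
  -- families.
  obtain rfl := hδ.isGeodesic_unique hf hX hu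
  have hN := Colombeau.isDeviation_deviationField hδ hf hX a b
  refine ⟨⟨_, hN, fun Y hY => Colombeau.isDeviation_unique hδ hf hX hY hN⟩, fun Y hY => ?_⟩
  obtain rfl := Colombeau.isDeviation_unique hδ hf hX hY hN
  exact ⟨hux.associated_x hδ hf a b, hux.associated_v hδ hf hb a b⟩
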